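/- Let $n\ge 1$. For $x\in\mathbb{R}^n$ and an orthogonal matrix $A\in \mathrm{O}_n$, let $[x,A]$ denote the isometry $z\mapsto A(z+x)$ of $\mathbb{R}^n$; the group $\mathrm{Iso}(\mathbb{R}^n)$ of all these carries the topology of $\mathbb{R}^n\times \mathrm{O}_n$. Let $\Gamma$ be a crystal group, i.e. a discrete subgroup of $\mathrm{Iso}(\mathbb{R}^n)$ such that the orbit space $\mathbb{R}^n/\Gamma$ is compact. Let $\Pi=\{A : [x,A]\in\Gamma \text{ for some } x\}$ be its point group, $\mathcal{L}=\{\ell\in\mathbb{R}^n : [\ell,\mathrm{id}]\in\Gamma\}$ its translation lattice and $\mathcal{L}^*=\{\nu\in\mathbb{R}^n : \nu\cdot\ell\in\mathbb{Z}\text{ for all }\ell\in\mathcal{L}\}$ the dual lattice. For each $L\in\Pi$ fix $x_L\in\mathbb{R}^n$ with $[x_L,L]\in\Gamma$. Fix $\omega_0\in\mathbb{R}^n$ such that, for $\nu\in\mathcal{L}^*$ and $M\in\Pi$, $M(\omega_0+\nu)=\omega_0$ only if $(\nu,M)=(0,\mathrm{id})$. Let $$\Omega=\{\omega\in\mathbb{R}^n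 : \|\omega-\omega_0\|<\|\omega-M(\omega_0+\nu)\| \text{ for all } (\nu,M)\in\mathcal{L}^*\times\Pi,\ (\nu,M)\ne(0,\mathrm{id})\}$$ be the corresponding Dirichlet domain of $\mathcal{L}^*\rtimes\Pi$, which acts by $(\nu,M)\cdot\omega=M(\omega+\nu)$, and let $\Pi\Omega=\bigcup_{M\in\Pi}M\Omega$. Both $\Omega$ and $\Pi\Omega$ carry Lebesgue measure. A measurable range function for $\ell^2(\mathcal{L}^*)$ based on $\Pi\Omega$ is a map $J$ from $\Pi\Omega$ to the set of closed subspaces of $\ell^2(\mathcal{L}^*)$ such that $\theta\mapsto\langle P_{J(\theta)}\xi,\eta\rangle$ is measurable for all $\xi,\eta\in\ell^2(\mathcal{L}^*)$, where $P_{J(\theta)}$ is the orthogonal projection onto $J(\theta)$. It is $\Pi$-invariant if, for every $L\in\Pi$, $J(L\theta)=J(\theta)$ for a.e. $\theta\in\Pi\Omega$. Let $\mathcal{M}_J=\{F\in L^2(\Pi\Omega,\ell^2(\mathcal{L}^*)) : F(\theta)\in J(\theta)\text{ for a.e. }\theta\in\Pi\Omega\}$. Let $(\delta_\nu)_{\nu\in\mathcal{L}^*}$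 be the standard orthonormal basis of $\ell^2(\mathcal{L}^*)$; inner products are linear in the first variable. Let $f\mapsto\hat f$ be the Fourier transform on $L^2(\mathbb{R}^n)$, the unitary extension of $\hat f(\omega)=\int_{\mathbb{R}^n} f(x)e^{2\pi i\omega\cdot x}\,dx$. A closed subspace $\mathcal{V}$ of $L^2(\mathbb{R}^n)$ is called $\Gamma$-shift invariant if, for every $f\in\mathcal{V}$ and every $g\in\Gamma$, the function $z\mapsto f(g^{-1}z)$ belongs to $\mathcal{V}$. **Theorem.** Let $\mathcal{V}$ be a closed subspace of $L^2(\mathbb{R}^n)$. Then $\mathcal{V}$ is $\Gamma$-shift invariant if and only if there is a $\Pi$-invariant measurable range function $J$ for $\ell^2(\mathcal{L}^*)$ based on $\Pi\Omega$ such that, for every $f\in L^2(\mathbb{R}^n)$, $f$ belongs to $\mathcal{V}$ if and only if there exists $F\in\mathcal{M}_J$ such that, for almost every $\omega\in\Omega$, every $L\in\Pi$ and every $\nu\in\mathcal{L}^*$, $$\hat f\big(L(\omega+\nu)\big)=e^{2\pi i\,\nu\cdot x_L}\,\langle F(L\omega),\delta_\nu\rangle .$$ -/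

import Mathlib

open MeasureTheory
open scoped FourierTransform ENNReal RealInnerProductSpace

noncomputable section

namespace CrystalShift

/-- Euclidean space `ℝⁿ`. -/
abbrev Euc (n : ℕ) : Type := EuclideanSpace ℝ (Fin n)

/-- The group of all isometries of `ℝⁿ`. The product is composition. -/
abbrev Iso (n : ℕ) : Type := Euc n ≃ᵃⁱ[ℝ] Euc n

/-- The linear part `A` of the isometry `[x, A] : z ↦ A (z + x)`. -/
def linPart {n : ℕ} (g : Iso n) : Euc n ≃ₗᵢ[ℝ] Euc n := g.linearIsometryEquiv

/-- The vector `x` of the isometry `[x, A] : z ↦ A (z + x)`, that is, `A⁻¹ (g 0)`. -/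
def shiftPart {n : ℕ} (g : Iso n) : Euc n := (linPart g).symm (g 0)

theorem iso_apply {n : ℕ} (g : Iso n) (z : Euc n) : g z = linPart g (z + shiftPart g) := by
  have h := g.map_vadd 0 z
  simp only [vadd_eq_add, add_zero] at h
  simp [linPart, shiftPart, h]

theorem linPart_one {n : ℕ} : linPart (1 : Iso n) = 1 := by
  ext v : 1
  have h := iso_apply (1 : Iso n) v
  simpa [shiftPart] using h.symm

theorem linPart_mul {n : ℕ} (g h : Iso n) : linPart (g * h) = linPart g * linPart h := by
  ext v : 1
  have e := (g * h).map_vadd 0 v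
  have e1 := h.map_vadd 0 v
  have e2 := g.map_vadd (h 0) (h.linearIsometryEquiv v)
  simp only [vadd_eq_add, add_zero, AffineIsometryEquiv.coe_mul, Function.comp_apply] at e e1 e2
  rw [e1, e2] at e
  exact (add_right_cancel e).symm

/-- The homomorphism `q : [x, A] ↦ A` onto the orthogonal group. -/
def linHom (n : ℕ) : Iso n →* (Euc n ≃ₗᵢ[ℝ] Euc n) where
  toFun := linPart
  map_one' := linPart_one
  map_mul' := linPart_mul

/-- The topology of the isometry group, as the product of the topology of `ℝⁿ` and that of the
orthogonal group (the norm topology on linear maps), through `[x, A] ↦ (x, A)`. -/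
@[reducible]
def isoTopology (n : ℕ) : TopologicalSpace (Iso n) :=
  TopologicalSpace.induced
    (fun g => (shiftPart g, ((linPart g).toContinuousLinearEquiv : Euc n →L[ℝ] Euc n)))
    inferInstance

/-- Two points of `ℝⁿ` are related when they lie in the same `Γ`-orbit. -/
def orbitSetoid {n : ℕ} (Γ : Subgroup (Iso n)) : Setoid (Euc n) where
  r x y := ∃ g ∈ Γ, g x = y
  iseqv :=
    { refl := fun x => ⟨1, Γ.one_mem, rfl⟩
      symm := by
        rintro x y ⟨g, hg, rfl⟩
        exact ⟨g⁻¹, Γ.inv_mem hg, g.symm_apply_apply x⟩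
      trans := by
        rintro x y z ⟨g, hg, rfl⟩ ⟨h, hh, rfl⟩
        exact ⟨h * g, Γ.mul_mem hh hg, rfl⟩ }

/-- A crystal group: a discrete subgroup `Γ` of the isometry group of `ℝⁿ` such that the orbit
space `ℝⁿ / Γ`, with the quotient topology, is compact. -/
structure IsCrystalGroup {n : ℕ} (Γ : Subgroup (Iso n)) : Prop where
  discrete : @DiscreteTopology Γ (TopologicalSpace.induced Subtype.val (isoTopology n))
  cocompact : CompactSpace (Quotient (orbitSetoid Γ))

/-- The point group `Π = q(Γ)`. -/
def pointGroup {n : ℕ} (Γ : Subgroup (Iso n)) : Subgroup (Euc n ≃ₗᵢ[ℝ] Euc n) :=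
  Γ.map (linHom n)

/-- The translation lattice: all `ℓ` such that the translation by `ℓ` belongs to `Γ`. -/
def lattice {n : ℕ} (Γ : Subgroup (Iso n)) : Set (Euc n) :=
  {ℓ | AffineIsometryEquiv.constVAdd ℝ (Euc n) ℓ ∈ Γ}

/-- The dual lattice: all `ν` with `ν · ℓ ∈ ℤ` for every `ℓ` in the translation lattice. -/
def dualLattice {n : ℕ} (Γ : Subgroup (Iso n)) : AddSubgroup (Euc n) where
  carrier := {ν | ∀ ℓ ∈ lattice Γ, ∃ m : ℤ, ⟪ν, ℓ⟫ = (m : ℝ)}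
  zero_mem' := fun ℓ _ => ⟨0, by simp⟩
  add_mem' := by
    intro a b ha hb ℓ hℓ
    obtain ⟨p, hp⟩ := ha ℓ hℓ
    obtain ⟨q, hq⟩ := hb ℓ hℓ
    exact ⟨p + q, by rw [inner_add_left, hp, hq]; push_cast; rfl⟩
  neg_mem' := by
    intro a ha ℓ hℓ
    obtain ⟨p, hp⟩ := ha ℓ hℓ
    exact ⟨-p, by rw [inner_neg_left, hp]; push_cast; rfl⟩

/-- The stabilizer of `ω₀` is trivial for the action `(ν, M) · ω = M (ω + ν)` of the semidirect
product of the dual lattice and the point group. -/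
def HasTrivialStabilizer {n : ℕ} (Γ : Subgroup (Iso n)) (ω₀ : Euc n) : Prop :=
  ∀ ν ∈ dualLattice Γ, ∀ M ∈ pointGroup Γ, M (ω₀ + ν) = ω₀ → ν = 0 ∧ M = 1

/-- The Dirichlet domain `Ω`, centred at `ω₀`, of the semidirect product of the dual lattice and
the point group: the points strictly nearer to `ω₀` than to `(ν, M) · ω₀`, for every
`(ν, M) ≠ (0, 1)`. -/
def dirichletDomain {n : ℕ} (Γ : Subgroup (Iso n)) (ω₀ : Euc n) : Set (Euc n) :=
  {ω | ∀ ν ∈ dualLattice Γ, ∀ M ∈ pointGroup Γ, ¬(ν = 0 ∧ M = 1) →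
    ‖ω - ω₀‖ < ‖ω - M (ω₀ + ν)‖}

/-- The set `ΠΩ`, the union of the images `M Ω` over the point group. -/
def pointOrbit {n : ℕ} (Γ : Subgroup (Iso n)) (ω₀ : Euc n) : Set (Euc n) :=
  {θ | ∃ M ∈ pointGroup Γ, ∃ ω ∈ dirichletDomain Γ ω₀, M ω = θ}

/-- The point `L ω` of `ΠΩ`, for `L` in the point group and `ω` in `Ω`. -/
def domToOrbit {n : ℕ} {Γ : Subgroup (Iso n)} {ω₀ : Euc n} (L : pointGroup Γ)
    (ω : dirichletDomain Γ ω₀) : pointOrbit Γ ω₀ :=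
  ⟨L.1 ω.1, L.1, L.2, ω.1, ω.2, rfl⟩

/-- The point `L θ` of `ΠΩ`, for `L` in the point group and `θ` in `ΠΩ`. -/
def orbitAct {n : ℕ} {Γ : Subgroup (Iso n)} {ω₀ : Euc n} (L : pointGroup Γ)
    (θ : pointOrbit Γ ω₀) : pointOrbit Γ ω₀ :=
  ⟨L.1 θ.1, by
    obtain ⟨M, hM, ω, hω, h⟩ := θ.2
    exact ⟨L.1 * M, Subgroup.mul_mem _ L.2 hM, ω, hω, by rw [← h]; rfl⟩⟩

/-- Lebesgue measure restricted to a subset `S` of `ℝⁿ`, as a measure on the subtype. -/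
def restrictedVolume {n : ℕ} (S : Set (Euc n)) : Measure S := volume.comap Subtype.val

/-- The Hilbert space `ℓ²` over the dual lattice. -/
abbrev EllTwo {n : ℕ} (Γ : Subgroup (Iso n)) : Type :=
  lp (fun _ : dualLattice Γ => ℂ) 2

open Classical in
/-- The standard basis vector `δ_ν`. -/
def delta {n : ℕ} {Γ : Subgroup (Iso n)} (ν : dualLattice Γ) : EllTwo Γ :=
  lp.single 2 ν (1 : ℂ)

/-- A measurable range function for the Hilbert space `H` based on the measurable space `X`: a map
`J` from `X` to the closed subspaces of `H` such that `x ↦ ⟨P_{J(x)} ξ, η⟩` is measurable for all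
`ξ, η`, where `P_K` is the orthogonal projection onto `K`. -/
def IsMeasurableRangeFunction {X H : Type*} [MeasurableSpace X] [NormedAddCommGroup H]
    [InnerProductSpace ℂ H] [CompleteSpace H] (J : X → ClosedSubmodule ℂ H) : Prop :=
  ∀ ξ η : H, Measurable fun x => inner ℂ ((J x).toSubmodule.starProjection ξ) η

/-- The space of all `F ∈ L²(X, H)` such that `F(x) ∈ J(x)` for almost every `x`. -/
def rangeSpace {X H : Type*} [MeasurableSpace X] (μ : Measure X) [NormedAddCommGroup H]
    [InnerProductSpace ℂ H] (J : X → ClosedSubmodule ℂ H) : Set (Lp H 2 μ) :=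
  {F | ∀ᵐ x ∂μ, F x ∈ J x}

/-- `J` is `Π`-invariant: `J(L θ) = J(θ)` for every `L ∈ Π` and almost every `θ ∈ ΠΩ`, with respect
to Lebesgue measure restricted to `ΠΩ`. -/
def IsPointInvariant {n : ℕ} {Γ : Subgroup (Iso n)} {ω₀ : Euc n}
    (J : pointOrbit Γ ω₀ → ClosedSubmodule ℂ (EllTwo Γ)) : Prop :=
  ∀ L : pointGroup Γ, ∀ᵐ θ ∂restrictedVolume (pointOrbit Γ ω₀), J (orbitAct L θ) = J θ

/-- The Hilbert space `L²(ℝⁿ)` of complex-valued functions. -/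
abbrev LTwo (n : ℕ) : Type := Lp ℂ 2 (volume : Measure (Euc n))

theorem measurePreserving_iso {n : ℕ} (g : Iso n) :
    MeasurePreserving (g : Euc n → Euc n) volume volume := by
  have h : (g : Euc n → Euc n) = linPart g ∘ fun z => z + shiftPart g := by
    funext z
    exact iso_apply g z
  rw [h]
  exact (linPart g).measurePreserving.comp (measurePreserving_add_right volume (shiftPart g))

/-- The shift by an isometry `g`, as an operator on `L²(ℝⁿ)`: `(π(g) f)(z) = f(g⁻¹ z)`. -/
def shift {n : ℕ} (g : Iso n) : LTwo n →ₗᵢ[ℂ] LTwo n :=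
  Lp.compMeasurePreservingₗᵢ ℂ (g⁻¹ : Iso n) (measurePreserving_iso g⁻¹)

/-- A subspace of `L²(ℝⁿ)` is `Γ`-shift invariant if it is mapped into itself by every `π(g)`,
`g ∈ Γ`. -/
def IsShiftInvariant {n : ℕ} (Γ : Subgroup (Iso n)) (V : ClosedSubmodule ℂ (LTwo n)) : Prop :=
  ∀ g ∈ Γ, ∀ f ∈ V, shift g f ∈ V

/-- The Plancherel extension to `L²(ℝⁿ)` of `f̂(ω) = ∫ f(x) e^{2πi ω·x} dx`. The exponent has a
positive sign, so that this transform is the one which Mathlib writes as the inverse transform. -/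
def hat {n : ℕ} (f : LTwo n) : LTwo n := 𝓕⁻ f

/-- The relation `f̂(L(ω + ν)) = e^{2πi ν·x_L} ⟨F(Lω), δ_ν⟩` for almost every `ω ∈ Ω`, every `L ∈ Π`
and every `ν` in the dual lattice. The inner product of Mathlib is linear in its second
argument. -/
def IsFiberTransform {n : ℕ} {Γ : Subgroup (Iso n)} {ω₀ : Euc n} (x : pointGroup Γ → Euc n)
    (f : LTwo n) (F : Lp (EllTwo Γ) 2 (restrictedVolume (pointOrbit Γ ω₀))) : Prop :=
  ∀ᵐ ω ∂restrictedVolume (dirichletDomain Γ ω₀), ∀ (L : pointGroup Γ) (ν : dualLattice Γ),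
    hat f (L.1 (ω.1 + ν.1)) =
      Complex.exp (2 * Real.pi * Complex.I * ((⟪ν.1, x L⟫ : ℝ) : ℂ)) *
        inner ℂ (delta ν) (F (domToOrbit L ω))

end CrystalShift

end

open CrystalShift

/-! The Fourier transform turns the shift by `g`, with linear part `A`, into `h ↦ e^{2πi ω·g(0)}
h(A⁻¹ω)` (`hat_shift`). Up to a null set, frequency space is the disjoint union of the tiles `L(Ω +
ν)` (`injective_tile`, `ae_mem_tile`). Collecting the values of `f̂` on the tiles, divided by
`e^{2πi ν·x_L}`, therefore gives a linear isometry `T` into `L²(ΠΩ, ℓ²)`, which is `fiberTransform`.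
Since `F` is determined by `f`, the condition on `f` in the theorem just says `T f ∈ M_J`. The
correction factors make `Γ` act on the fibers by scalars: `T(π(g)f)(θ) = e^{2πi θ·g(0)} (T f)(A⁻¹θ)`
(`fiberTransform_shift`).

If `J` is `Π`-invariant, this formula shows that `M_J` is preserved. Conversely, let `V` be
invariant, let `f_k` be dense in `V`, and let `J(θ)` be the closed span of the vectors `(T f_k)(θ)`.
Invariance of `V` gives invariance of `J`, and `T` maps `V` into `M_J` because `M_J` is closed. Now
suppose `T p ∈ M_J`, and let `q` be the component of `p` orthogonal to `V`. Then `q` is orthogonal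
to all lattice translates of every `f_k`. Those translates are multiplications by the characters
`e^{2πi θ·ℓ}`, and `ΠΩ` embeds in the torus `ℝⁿ/L*`, so `⟨T f_k, T q⟩` has vanishing Fourier
coefficients and is zero almost everywhere (`ae_eq_zero_of_integral_phase`). As `(T q)(θ)` lies in
`J(θ)` and is orthogonal to its generators, `q = 0`. Surjectivity of `T` is never needed.

The lattice geometry does not invoke Bieberbach's theorem: the trivial stabilizer makes `Π` act
faithfully on the lattice, whence `Π` is finite, and cocompactness then gives full rank. -/

/-! ### Characters, and the Fourier transform of a shift. -/

noncomputable section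
open scoped SchwartzMap
namespace CrystalShift

/-- The character `ω ↦ e^{2πi ω·a}`. -/
def phase {n : ℕ} (a ω : Euc n) : ℂ := Complex.exp (2 * Real.pi * Complex.I * ((⟪ω, a⟫ : ℝ) : ℂ))

theorem norm_phase {n : ℕ} (a ω : Euc n) : ‖phase a ω‖ = 1 := by
  rw [phase, show (2 * Real.pi * Complex.I * ((⟪ω, a⟫ : ℝ) : ℂ) : ℂ)
    = ((2 * Real.pi * ⟪ω, a⟫ : ℝ) : ℂ) * Complex.I by push_cast; ring]
  exact Complex.norm_exp_ofReal_mul_I _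

theorem phase_ne_zero {n : ℕ} (a ω : Euc n) : phase a ω ≠ 0 := Complex.exp_ne_zero _

theorem continuous_phase {n : ℕ} (a : Euc n) : Continuous (phase a) := by
  unfold phase; fun_prop

theorem phase_add_left {n : ℕ} (a b ω : Euc n) : phase (a + b) ω = phase a ω * phase b ω := by
  simp only [phase, inner_add_right, ← Complex.exp_add]
  congr 1; push_cast; ring

theorem phase_add_right {n : ℕ} (a ω η : Euc n) : phase a (ω + η) = phase a ω * phase a η := by
  simp only [phase, inner_add_left, ← Complex.exp_add]
  congr 1; push_cast; ring

theorem phase_map_symm {n : ℕ} (A : Euc n ≃ₗᵢ[ℝ] Euc n) (a ω : Euc n) :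
    phase a (A.symm ω) = phase (A a) ω := by
  have : ⟪A.symm ω, a⟫ = ⟪ω, A a⟫ := by
    rw [← A.inner_map_map, A.apply_symm_apply]
  simp only [phase, this]

theorem phase_eq_fourierChar {n : ℕ} (a ω : Euc n) : phase a ω = (Real.fourierChar ⟪ω, a⟫ : ℂ) := by
  rw [Real.fourierChar_apply, phase]
  congr 1; push_cast; ring

theorem memLp_phase_mul {n : ℕ} (a : Euc n) (h : LTwo n) :
    MemLp (fun ω => phase a ω * h ω) 2 volume :=
  (Lp.memLp h).of_le ((continuous_phase a).aestronglyMeasurable.mul (Lp.aestronglyMeasurable h))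
    (.of_forall fun ω => by rw [norm_mul, norm_phase, one_mul])

/-- Multiplication by a character, on `L²`. -/
def mulPhase {n : ℕ} (a : Euc n) : LTwo n →ₗᵢ[ℂ] LTwo n where
  toFun h := (memLp_phase_mul a h).toLp
  map_add' f g := by
    rw [← MemLp.toLp_add, MemLp.toLp_eq_toLp_iff]
    filter_upwards [Lp.coeFn_add f g] with ω h
    simp only [Pi.add_apply, h, mul_add]
  map_smul' c f := by
    rw [RingHom.id_apply, ← MemLp.toLp_const_smul, MemLp.toLp_eq_toLp_iff]
    filter_upwards [Lp.coeFn_smul c f] with ω h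
    simp only [Pi.smul_apply, h, smul_eq_mul]; ring
  norm_map' f := by
    simp only [LinearMap.coe_mk, AddHom.coe_mk, Lp.norm_def]
    congr 1
    refine eLpNorm_congr_norm_ae ?_
    filter_upwards [(memLp_phase_mul a f).coeFn_toLp] with ω h
    rw [h, norm_mul, norm_phase, one_mul]

theorem mulPhase_ae {n : ℕ} (a : Euc n) (h : LTwo n) :
    mulPhase a h =ᵐ[volume] fun ω => phase a ω * h ω :=
  (memLp_phase_mul a h).coeFn_toLp

theorem shift_ae {n : ℕ} (g : Iso n) (f : LTwo n) :
    shift g f =ᵐ[volume] fun z => f ((g⁻¹ : Iso n) z) :=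
  Lp.coeFn_compMeasurePreserving f (measurePreserving_iso g⁻¹)

theorem iso_inv_apply {n : ℕ} (g : Iso n) (z : Euc n) :
    (g⁻¹ : Iso n) z = (linPart g).symm (z - g 0) := by
  have h : g ((linPart g).symm (z - g 0)) = z := by
    rw [iso_apply g, shiftPart, ← map_add, LinearIsometryEquiv.apply_symm_apply, sub_add_cancel]
  conv_lhs => rw [← h]
  exact g.symm_apply_apply _

theorem fourierInv_comp_iso_inv {n : ℕ} (g : Iso n) (f : Euc n → ℂ) (ω : Euc n) :
    𝓕⁻ (fun z => f ((g⁻¹ : Iso n) z)) ω = phase (g 0) ω * 𝓕⁻ f ((linPart g).symm ω) := by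
  rw [Real.fourierInv_eq, Real.fourierInv_eq,
    ← (measurePreserving_iso g).integral_comp g.toHomeomorph.measurableEmbedding,
    ← smul_eq_mul, ← integral_smul]
  refine integral_congr_ae (.of_forall fun z => ?_)
  have h1 : (g⁻¹ : Iso n) (g z) = z := g.symm_apply_apply z
  have h2 : ⟪g z, ω⟫ = ⟪ω, g 0⟫ + ⟪z, (linPart g).symm ω⟫ := by
    rw [iso_apply g z, map_add, shiftPart, LinearIsometryEquiv.apply_symm_apply, inner_add_left,
      add_comm, real_inner_comm]
    congr 1
    rw [← (linPart g).inner_map_map z, LinearIsometryEquiv.apply_symm_apply]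
  simp only [h1, h2, phase_eq_fourierChar, Real.fourierChar.map_add_eq_mul, Circle.smul_def,
    smul_eq_mul, Circle.coe_mul, mul_assoc]

/-- Both sides are continuous in `f`, so it suffices to treat Schwartz functions, where the
transform is an integral and the substitution `z ↦ g z` gives the formula. -/
theorem hat_shift {n : ℕ} (g : Iso n) (f : LTwo n) :
    hat (shift g f) =ᵐ[volume] fun ω => phase (g 0) ω * hat f ((linPart g).symm ω) := by
  have key : hat (shift g f) = mulPhase (g 0) (Lp.compMeasurePreservingₗᵢ ℂ (linPart g).symm
      (linPart g).symm.measurePreserving (hat f)) := by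
    induction f using (SchwartzMap.denseRange_toLpCLM (E := Euc n) (F := ℂ) (p := 2)
      ENNReal.ofNat_ne_top (μ := volume)).induction_on with
    | hp =>
      refine isClosed_eq ?_ ?_
      · exact (Lp.fourierTransformₗᵢ (Euc n) ℂ).symm.continuous.comp (shift g).continuous
      · exact (LinearIsometry.continuous _).comp ((LinearIsometry.continuous _).comp
          (Lp.fourierTransformₗᵢ (Euc n) ℂ).symm.continuous)
    | ih s =>
      have hg : Function.HasTemperateGrowth (g⁻¹ : Iso n) := by
        have : ((g⁻¹ : Iso n) : Euc n → Euc n) = fun z => (linPart g).symm z - (linPart g).symm (g 0) := by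
          funext z; rw [iso_inv_apply, map_sub]
        rw [this]
        exact (((linPart g).symm : Euc n →L[ℝ] Euc n).hasTemperateGrowth).sub
          (Function.HasTemperateGrowth.const _)
      let s' : 𝓢(Euc n, ℂ) := SchwartzMap.compCLMOfAntilipschitz ℂ hg
        (g⁻¹ : Iso n).isometry.antilipschitz s
      have e1 : shift g (s.toLp 2) = s'.toLp 2 := by
        apply Lp.ext
        have h1 := (measurePreserving_iso g⁻¹).quasiMeasurePreserving.ae_eq_comp (s.coeFn_toLp 2 volume)
        filter_upwards [shift_ae g (s.toLp 2), s'.coeFn_toLp 2, h1] with z h1 h2 h3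
        rw [h1, h2]; exact h3
      change hat (shift g (s.toLp 2)) = mulPhase (g 0) (Lp.compMeasurePreservingₗᵢ ℂ (linPart g).symm
        (linPart g).symm.measurePreserving (hat (s.toLp 2)))
      rw [e1]
      simp only [hat, SchwartzMap.toLp_fourierInv_eq]
      apply Lp.ext
      have h3 := (linPart g).symm.measurePreserving.quasiMeasurePreserving.ae_eq_comp
        ((𝓕⁻ s).coeFn_toLp 2 volume)
      filter_upwards [(𝓕⁻ s').coeFn_toLp 2, mulPhase_ae (g 0) (Lp.compMeasurePreservingₗᵢ ℂ
        (linPart g).symm (linPart g).symm.measurePreserving ((𝓕⁻ s).toLp 2)),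
        Lp.coeFn_compMeasurePreserving ((𝓕⁻ s).toLp 2) (linPart g).symm.measurePreserving, h3]
        with ω h1 h2 h3 h4
      rw [h1, h2]
      refine Eq.trans ?_ (congrArg _ (h3.trans h4).symm)
      simp only [Function.comp_apply, SchwartzMap.fourierInv_coe]
      exact fourierInv_comp_iso_inv g s ω
  rw [key]
  filter_upwards [mulPhase_ae (g 0) (Lp.compMeasurePreservingₗᵢ ℂ
        (linPart g).symm (linPart g).symm.measurePreserving (hat f)),
        Lp.coeFn_compMeasurePreserving (hat f) (linPart g).symm.measurePreserving] with ω h1 h2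
  rw [h1]; exact congrArg _ h2

end CrystalShift
end

/-! ### The translation lattice, its dual and the point group. -/

noncomputable section
namespace CrystalShift

variable {n : ℕ} {Γ : Subgroup (Iso n)}

theorem iso_map_add (g : Iso n) (v z : Euc n) : g (v + z) = linPart g v + g z := by
  simpa only [vadd_eq_add, linPart] using g.map_vadd z v

theorem linPart_constVAdd (v : Euc n) :
    linPart (AffineIsometryEquiv.constVAdd ℝ (Euc n) v) = 1 := by
  ext z : 1
  have := iso_map_add (AffineIsometryEquiv.constVAdd ℝ (Euc n) v) z 0
  simp only [AffineIsometryEquiv.coe_constVAdd, vadd_eq_add, add_zero] at this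
  rw [add_comm] at this
  exact (add_right_cancel this).symm

theorem shiftPart_constVAdd (v : Euc n) :
    shiftPart (AffineIsometryEquiv.constVAdd ℝ (Euc n) v) = v := by
  rw [shiftPart, linPart_constVAdd]
  exact add_zero v

theorem linPart_map_mem_lattice {g : Iso n} (hg : g ∈ Γ) {ℓ : Euc n} (hℓ : ℓ ∈ lattice Γ) :
    linPart g ℓ ∈ lattice Γ := by
  have : AffineIsometryEquiv.constVAdd ℝ (Euc n) (linPart g ℓ)
      = g * AffineIsometryEquiv.constVAdd ℝ (Euc n) ℓ * g⁻¹ := by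
    ext1 z
    simp [iso_map_add]
  simp only [lattice, Set.mem_ofPred_eq, this]
  exact Γ.mul_mem (Γ.mul_mem hg hℓ) (Γ.inv_mem hg)

theorem pointGroup_map_mem_lattice {M : Euc n ≃ₗᵢ[ℝ] Euc n} (hM : M ∈ pointGroup Γ) {ℓ : Euc n}
    (hℓ : ℓ ∈ lattice Γ) : M ℓ ∈ lattice Γ := by
  obtain ⟨g, hg, rfl⟩ := hM
  exact linPart_map_mem_lattice hg hℓ

theorem pointGroup_map_mem_dualLattice {M : Euc n ≃ₗᵢ[ℝ] Euc n} (hM : M ∈ pointGroup Γ)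
    {ν : Euc n} (hν : ν ∈ dualLattice Γ) : M ν ∈ dualLattice Γ := by
  intro ℓ hℓ
  obtain ⟨m, hm⟩ := hν _ (pointGroup_map_mem_lattice (inv_mem hM) hℓ)
  refine ⟨m, ?_⟩
  rw [← hm, ← M.inner_map_map ν]
  congr 1
  exact (M.apply_symm_apply ℓ).symm

/-- With equal linear parts, `h⁻¹ g` is the translation by the difference of the shift parts; so
`x_L` is determined by `L` modulo the lattice. -/
theorem shiftPart_sub_mem_lattice {g h : Iso n} (hg : g ∈ Γ) (hh : h ∈ Γ)
    (e : linPart g = linPart h) : shiftPart g - shiftPart h ∈ lattice Γ := by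
  have : AffineIsometryEquiv.constVAdd ℝ (Euc n) (shiftPart g - shiftPart h) = h⁻¹ * g := by
    rw [eq_inv_mul_iff_mul_eq]
    ext1 z
    rw [AffineIsometryEquiv.coe_mul, Function.comp_apply, iso_apply g, e, iso_apply h]
    simp only [AffineIsometryEquiv.coe_constVAdd, vadd_eq_add]
    congr 1; abel
  simp only [lattice, Set.mem_ofPred_eq, this]
  exact Γ.mul_mem (Γ.inv_mem hh) hg

/-- The translation lattice, as a submodule over the integers. -/
def latticeSubmodule (Γ : Subgroup (Iso n)) : Submodule ℤ (Euc n) :=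
  AddSubgroup.toIntSubmodule
    { carrier := lattice Γ
      zero_mem' := by
        have : AffineIsometryEquiv.constVAdd ℝ (Euc n) 0 = 1 := by ext1 z; simp
        simp only [lattice, Set.mem_ofPred_eq, this, Γ.one_mem]
      add_mem' := by
        intro a b ha hb
        have : AffineIsometryEquiv.constVAdd ℝ (Euc n) (a + b)
          = AffineIsometryEquiv.constVAdd ℝ (Euc n) a * AffineIsometryEquiv.constVAdd ℝ (Euc n) b := by
          ext1 z; simp [add_assoc]
        simp only [lattice, Set.mem_ofPred_eq, this]
        exact Γ.mul_mem ha hb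
      neg_mem' := by
        intro a ha
        have : AffineIsometryEquiv.constVAdd ℝ (Euc n) (-a)
          = (AffineIsometryEquiv.constVAdd ℝ (Euc n) a)⁻¹ := by
          rw [eq_inv_iff_mul_eq_one]
          ext1 z; simp
        simp only [lattice, Set.mem_ofPred_eq, this]
        exact Γ.inv_mem ha }

theorem mem_latticeSubmodule {ℓ : Euc n} : ℓ ∈ latticeSubmodule Γ ↔ ℓ ∈ lattice Γ := Iff.rfl

theorem discreteTopology_latticeSubmodule (hΓ : IsCrystalGroup Γ) :
    DiscreteTopology (latticeSubmodule Γ) := by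
  let _ : TopologicalSpace Γ := TopologicalSpace.induced Subtype.val (isoTopology n)
  have : DiscreteTopology Γ := hΓ.discrete
  let φ : latticeSubmodule Γ → Γ := fun ℓ => ⟨AffineIsometryEquiv.constVAdd ℝ (Euc n) ℓ.1, ℓ.2⟩
  have hφ : Continuous φ := by
    refine continuous_induced_rng.2 ?_
    let _ := isoTopology n
    refine continuous_induced_rng.2 ?_
    refine Continuous.prodMk ?_ ?_
    · simp only [Function.comp_apply, φ, shiftPart_constVAdd]
      exact continuous_subtype_val
    · simp only [Function.comp_apply, φ, linPart_constVAdd]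
      exact continuous_const
  refine DiscreteTopology.of_continuous_injective hφ fun a b hab => Subtype.ext ?_
  have := congrArg (fun g : Γ => shiftPart g.1) hab
  simpa only [φ, shiftPart_constVAdd] using this

/-- If `M` fixes the lattice pointwise, `M⁻¹ω₀ - ω₀` is orthogonal to the lattice, hence lies in the
dual lattice, and together with `M` it stabilizes `ω₀`. -/
theorem eq_one_of_fix_lattice {ω₀ : Euc n} (hω₀ : HasTrivialStabilizer Γ ω₀)
    {M : Euc n ≃ₗᵢ[ℝ] Euc n} (hM : M ∈ pointGroup Γ) (h : ∀ ℓ ∈ lattice Γ, M ℓ = ℓ) : M = 1 := by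
  refine (hω₀ (M.symm ω₀ - ω₀) (fun ℓ hℓ => ⟨0, ?_⟩) M hM (by simp)).2
  have : ⟪M.symm ω₀, ℓ⟫ = ⟪ω₀, ℓ⟫ := by
    rw [← M.inner_map_map, M.apply_symm_apply, h ℓ hℓ]
  simp [inner_sub_left, this]

/-- The discrete lattice is finitely generated. By faithfulness an element of `Π` is determined by
the images of the generators, and these are lattice points of prescribed norm, finitely many. -/
theorem finite_pointGroup (hΓ : IsCrystalGroup Γ) {ω₀ : Euc n}
    (hω₀ : HasTrivialStabilizer Γ ω₀) : Finite (pointGroup Γ) := by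
  have := discreteTopology_latticeSubmodule hΓ
  obtain ⟨S, hS⟩ := Module.Finite.iff_fg.1 (inferInstance : Module.Finite ℤ (latticeSubmodule Γ))
  have hfin : ∀ r : ℝ, (Metric.closedBall (0 : Euc n) r ∩ (latticeSubmodule Γ : Set (Euc n))).Finite := by
    intro r
    change ((_ : Set (Euc n)) ∩ (latticeSubmodule Γ).toAddSubgroup).Finite
    have : DiscreteTopology (latticeSubmodule Γ).toAddSubgroup :=
      (inferInstance : DiscreteTopology (latticeSubmodule Γ))
    exact Metric.finite_isBounded_inter_isClosed DiscreteTopology.isDiscrete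
        Metric.isBounded_closedBall inferInstance
  have hSL : ∀ s ∈ S, s ∈ latticeSubmodule Γ := fun s hs => hS ▸ Submodule.subset_span hs
  let φ : pointGroup Γ → ∀ s : S, ↥(Metric.closedBall (0 : Euc n) ‖s.1‖ ∩
      (latticeSubmodule Γ : Set (Euc n))) := fun M s =>
    ⟨M.1 s.1, by simp, pointGroup_map_mem_lattice M.2 (hSL s.1 s.2)⟩
  have : ∀ s : S, Finite ↥(Metric.closedBall (0 : Euc n) ‖s.1‖ ∩
      (latticeSubmodule Γ : Set (Euc n))) := fun s => hfin _
  refine Finite.of_injective φ fun M N hMN => ?_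
  have h1 : ∀ s ∈ S, M.1 s = N.1 s := fun s hs =>
    congrArg Subtype.val (congrFun hMN ⟨s, hs⟩)
  have h2 : ∀ ℓ ∈ lattice Γ, M.1 ℓ = N.1 ℓ := by
    intro ℓ hℓ
    have : ℓ ∈ Submodule.span ℤ (S : Set (Euc n)) := hS ▸ (mem_latticeSubmodule.2 hℓ)
    induction this using Submodule.span_induction with
    | mem x hx => exact h1 x hx
    | zero => simp
    | add x y hx' hy' hx hy =>
      have hx' : x ∈ lattice Γ := mem_latticeSubmodule.1 (hS ▸ hx')
      have hy' : y ∈ lattice Γ := mem_latticeSubmodule.1 (hS ▸ hy')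
      simp [hx hx', hy hy']
    | smul c x hx' hx =>
      have hx' : x ∈ lattice Γ := mem_latticeSubmodule.1 (hS ▸ hx')
      rw [map_zsmul, map_zsmul, hx hx']
  have h3 := eq_one_of_fix_lattice hω₀ (N⁻¹ * M).2 fun ℓ hℓ => by
    change N.1.symm (M.1 ℓ) = ℓ
    rw [h2 ℓ hℓ, LinearIsometryEquiv.symm_apply_apply]
  exact (inv_mul_eq_one.1 (Subtype.ext h3 : N⁻¹ * M = 1)).symm

theorem exists_bounded_orbit_representative (hΓ : IsCrystalGroup Γ) :
    ∃ R : ℝ, ∀ z : Euc n, ∃ g ∈ Γ, ‖g z‖ < R := by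
  have := hΓ.cocompact
  let U : ℕ → Set (Quotient (orbitSetoid Γ)) := fun k =>
    Quotient.mk (orbitSetoid Γ) '' Metric.ball 0 k
  have hU : ∀ k, IsOpen (U k) := by
    intro k
    rw [← isQuotientMap_quotient_mk'.isOpen_preimage]
    -- The saturation of a ball is the union of its preimages under `Γ`, so the images of the balls
    -- form an increasing open cover of the compact quotient.
    have : Quotient.mk (orbitSetoid Γ) ⁻¹' U k
        = ⋃ g : Γ, (g.1 : Euc n → Euc n) ⁻¹' Metric.ball 0 k := by
      ext z
      simp only [Set.mem_preimage, U, Set.mem_image, Set.mem_iUnion]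
      constructor
      · rintro ⟨y, hy, e⟩
        obtain ⟨g, hg, rfl⟩ := (orbitSetoid Γ).symm (Quotient.exact e)
        exact ⟨⟨g, hg⟩, hy⟩
      · rintro ⟨g, hg⟩
        exact ⟨_, hg, Quotient.sound ((orbitSetoid Γ).symm ⟨g.1, g.2, rfl⟩)⟩
    change IsOpen (Quotient.mk (orbitSetoid Γ) ⁻¹' U k)
    rw [this]
    exact isOpen_iUnion fun g => Metric.isOpen_ball.preimage g.1.continuous
  have hcov : (Set.univ : Set (Quotient (orbitSetoid Γ))) ⊆ ⋃ k, U k := by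
    intro q _
    induction q using Quotient.inductionOn with
    | h z =>
      obtain ⟨k, hk⟩ := exists_nat_gt ‖z‖
      exact Set.mem_iUnion.2 ⟨k, z, by simpa using hk, rfl⟩
  obtain ⟨k, hk⟩ := isCompact_univ.elim_directed_cover U hU hcov
    (Monotone.directed_le fun i j hij => Set.image_mono
      (Metric.ball_subset_ball (Nat.cast_le.2 hij)))
  refine ⟨k, fun z => ?_⟩
  obtain ⟨y, hy, e⟩ := hk (Set.mem_univ (Quotient.mk (orbitSetoid Γ) z))
  obtain ⟨g, hg, rfl⟩ := (orbitSetoid Γ).symm (Quotient.exact e)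
  exact ⟨g, hg, by simpa using hy⟩

/-- Some `g ∈ Γ` moves `z` into a fixed ball. Replacing `g⁻¹` by the chosen representative of its
linear part changes the result by a lattice vector, and there are only finitely many
representatives. -/
theorem exists_lattice_near (hΓ : IsCrystalGroup Γ) {ω₀ : Euc n}
    (hω₀ : HasTrivialStabilizer Γ ω₀) : ∃ C : ℝ, ∀ z : Euc n, ∃ ℓ ∈ lattice Γ, ‖z - ℓ‖ ≤ C := by
  have := finite_pointGroup hΓ hω₀
  have := Fintype.ofFinite (pointGroup Γ)
  obtain ⟨R, hR⟩ := exists_bounded_orbit_representative hΓ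
  have hrep : ∀ M : pointGroup Γ, ∃ g ∈ Γ, linPart g = M.1 := fun M => M.2
  choose γ hγ hγM using hrep
  refine ⟨R + ∑ M, ‖shiftPart (γ M)‖, fun z => ?_⟩
  obtain ⟨g, hg, hz⟩ := hR z
  let M : pointGroup Γ := ⟨linPart g⁻¹, g⁻¹, Γ.inv_mem hg, rfl⟩
  have hM := hγM M
  refine ⟨M.1 (shiftPart g⁻¹ - shiftPart (γ M)), pointGroup_map_mem_lattice M.2
    (shiftPart_sub_mem_lattice (Γ.inv_mem hg) (hγ M) (hγM M).symm), ?_⟩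
  have h1 : z = M.1 (g z + shiftPart g⁻¹) := by
    change z = linPart g⁻¹ _
    rw [← iso_apply g⁻¹]
    exact (g.symm_apply_apply z).symm
  have h2 : z - M.1 (shiftPart g⁻¹ - shiftPart (γ M)) = M.1 (g z + shiftPart (γ M)) := by
    conv_lhs => rw [h1]
    rw [← map_sub]; congr 1; abel
  rw [h2, LinearIsometryEquiv.norm_map]
  exact (norm_add_le _ _).trans (add_le_add hz.le
    (Finset.single_le_sum (f := fun M => ‖shiftPart (γ M)‖) (fun _ _ => norm_nonneg _)
      (Finset.mem_univ M)))

theorem span_lattice_eq_top (hΓ : IsCrystalGroup Γ) {ω₀ : Euc n}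
    (hω₀ : HasTrivialStabilizer Γ ω₀) :
    Submodule.span ℝ (latticeSubmodule Γ : Set (Euc n)) = ⊤ := by
  obtain ⟨C, hC⟩ := exists_lattice_near hΓ hω₀
  rw [← Submodule.orthogonal_eq_bot_iff, Submodule.eq_bot_iff]
  intro v hv
  by_contra hv0
  have hvp : 0 < ‖v‖ := norm_pos_iff.2 hv0
  -- This multiple of `v` has norm `|C| + 1`; being orthogonal to the lattice, it is at distance at
  -- least `|C| + 1` from every lattice point.
  obtain ⟨ℓ, hℓ, hb⟩ := hC (((|C| + 1) / ‖v‖) • v)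
  have h0 : ⟪((|C| + 1) / ‖v‖) • v, ℓ⟫ = 0 := by
    rw [inner_smul_left, Submodule.inner_left_of_mem_orthogonal
      (Submodule.subset_span hℓ) hv, mul_zero]
  have h1 := norm_sub_sq_real (((|C| + 1) / ‖v‖) • v) ℓ
  rw [h0, norm_smul, norm_div, norm_norm, div_mul_cancel₀ _ hvp.ne', Real.norm_eq_abs,
    abs_of_pos (by positivity : 0 < |C| + 1)] at h1
  nlinarith [norm_nonneg (((|C| + 1) / ‖v‖) • v - ℓ), norm_nonneg ℓ, le_abs_self C, abs_nonneg C]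

theorem exists_lattice_basis (hΓ : IsCrystalGroup Γ) {ω₀ : Euc n}
    (hω₀ : HasTrivialStabilizer Γ ω₀) :
    ∃ (ι : Type) (_ : Fintype ι) (b : Module.Basis ι ℝ (Euc n)),
      (∀ i, b i ∈ lattice Γ) ∧ ∀ ν, ν ∈ dualLattice Γ ↔ ∀ i, ∃ m : ℤ, ⟪ν, b i⟫ = m := by
  have := discreteTopology_latticeSubmodule hΓ
  have : IsZLattice ℝ (latticeSubmodule Γ) := ⟨span_lattice_eq_top hΓ hω₀⟩
  let b := (Module.Free.chooseBasis ℤ (latticeSubmodule Γ)).ofZLatticeBasis ℝ (latticeSubmodule Γ)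
  have hb : Submodule.span ℤ (Set.range b) = latticeSubmodule Γ :=
    Module.Basis.ofZLatticeBasis_span ℝ (L := latticeSubmodule Γ) _
  have hmem : ∀ i, b i ∈ lattice Γ := fun i =>
    mem_latticeSubmodule.1 (hb.le (Submodule.subset_span ⟨i, rfl⟩))
  refine ⟨_, inferInstance, b, hmem, fun ν => ⟨fun h i => h _ (hmem i), fun h ℓ hℓ => ?_⟩⟩
  have hℓ' := hb.ge (mem_latticeSubmodule.2 hℓ)
  clear hℓ
  induction hℓ' using Submodule.span_induction with
  | mem x hx => obtain ⟨i, rfl⟩ := hx; exact h i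
  | zero => exact ⟨0, by simp⟩
  | add x y _ _ hx hy =>
    obtain ⟨p, hp⟩ := hx
    obtain ⟨q, hq⟩ := hy
    exact ⟨p + q, by rw [inner_add_right, hp, hq]; push_cast; rfl⟩
  | smul c x _ hx =>
    obtain ⟨p, hp⟩ := hx
    refine ⟨c * p, ?_⟩
    rw [← Int.cast_smul_eq_zsmul ℝ, inner_smul_right, hp]; push_cast; rfl

/-- The integers `ν · b i` determine `ν`, and Cauchy–Schwarz bounds them on a ball. -/
theorem finite_dualLattice_ball (hΓ : IsCrystalGroup Γ) {ω₀ : Euc n}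
    (hω₀ : HasTrivialStabilizer Γ ω₀) (R : ℝ) : {ν : dualLattice Γ | ‖ν.1‖ ≤ R}.Finite := by
  obtain ⟨ι, _, b, hb, hd⟩ := exists_lattice_basis hΓ hω₀
  choose m hm using fun ν : dualLattice Γ => (hd ν.1).1 ν.2
  have hinj : Function.Injective m := fun ν μ h => by
    apply Subtype.ext
    refine InnerProductSpace.ext_inner_right_basis b fun i => ?_
    rw [hm ν i, hm μ i, h]
  refine Set.Finite.of_finite_image (f := m) (Set.Finite.subset (Set.Finite.pi'
    (t := fun i => Set.Icc (-⌈R * ‖b i‖⌉) ⌈R * ‖b i‖⌉) fun i => Set.finite_Icc _ _) ?_) hinj.injOn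
  rintro _ ⟨ν, hν, rfl⟩ i
  have h1 : |((m ν i : ℤ) : ℝ)| ≤ R * ‖b i‖ := by
    rw [← hm ν i]
    exact (abs_real_inner_le_norm _ _).trans (mul_le_mul_of_nonneg_right hν (norm_nonneg _))
  have h2 := abs_le.1 (h1.trans (Int.le_ceil _))
  exact ⟨by exact_mod_cast h2.1, by exact_mod_cast h2.2⟩

theorem countable_dualLattice (hΓ : IsCrystalGroup Γ) {ω₀ : Euc n}
    (hω₀ : HasTrivialStabilizer Γ ω₀) : Countable (dualLattice Γ) := by
  rw [← Set.countable_univ_iff]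
  refine (Set.countable_iUnion fun k : ℕ => (finite_dualLattice_ball hΓ hω₀ k).countable).mono ?_
  intro ν _
  obtain ⟨k, hk⟩ := exists_nat_ge ‖ν.1‖
  exact Set.mem_iUnion.2 ⟨k, hk⟩

end CrystalShift
end

/-! ### The Dirichlet domain tiles frequency space. -/

noncomputable section
namespace CrystalShift

variable {n : ℕ} {Γ : Subgroup (Iso n)} {ω₀ : Euc n}

/-- Otherwise apply the strict inequality at `ω` to `(ν, M)` and at `ω'` to the inverse `(-Mν,
M⁻¹)`. As the action is isometric, each of `‖ω - ω₀‖` and `‖ω' - ω₀‖` would be smaller than the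
other. -/
theorem eq_zero_and_eq_one_of_mem_dirichletDomain {ω ω' ν : Euc n} {M : Euc n ≃ₗᵢ[ℝ] Euc n}
    (hω : ω ∈ dirichletDomain Γ ω₀) (hω' : ω' ∈ dirichletDomain Γ ω₀) (hν : ν ∈ dualLattice Γ)
    (hM : M ∈ pointGroup Γ) (h : ω = M (ω' + ν)) : ν = 0 ∧ M = 1 := by
  by_contra hne
  have h1 := hω ν hν M hM hne
  have h2 := hω' (-(M ν)) (neg_mem (pointGroup_map_mem_dualLattice hM hν)) M⁻¹ (inv_mem hM) (by
    rintro ⟨a, b⟩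
    exact hne ⟨by simpa using a, by simpa using b⟩)
  have e1 : ‖ω - M (ω₀ + ν)‖ = ‖ω' - ω₀‖ := by
    rw [h, ← map_sub, LinearIsometryEquiv.norm_map, add_sub_add_right_eq_sub]
  have e2 : ‖ω' - M⁻¹ (ω₀ + -(M ν))‖ = ‖ω - ω₀‖ := by
    rw [← M.norm_map (ω' - _), map_sub]
    have : M (M⁻¹ (ω₀ + -(M ν))) = ω₀ - M ν := by
      rw [← sub_eq_add_neg]; exact M.apply_symm_apply _
    rw [this, h, map_add]
    congr 1; abel
  linarith

theorem injective_tile {ω ω' : Euc n} (hω : ω ∈ dirichletDomain Γ ω₀)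
    (hω' : ω' ∈ dirichletDomain Γ ω₀) {M M' : pointGroup Γ} {ν ν' : dualLattice Γ}
    (h : M.1 (ω + ν.1) = M'.1 (ω' + ν'.1)) : M = M' ∧ ν = ν' ∧ ω = ω' := by
  have hs : ∀ (z : Euc n), M.1⁻¹ (M.1 z) = z := fun z => M.1.symm_apply_apply z
  have hs' : ∀ (z : Euc n), M'.1 (M'.1⁻¹ z) = z := fun z => M'.1.apply_symm_apply z
  have h1 : ω = (M.1⁻¹ * M'.1) (ω' + (ν'.1 - M'.1⁻¹ (M.1 ν.1))) := by
    rw [LinearIsometryEquiv.coe_mul, Function.comp_apply, ← add_sub_assoc, map_sub, ← h, hs',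
      ← map_sub, hs, add_sub_cancel_right]
  obtain ⟨h2, h3⟩ := eq_zero_and_eq_one_of_mem_dirichletDomain hω hω'
    (sub_mem ν'.2 (pointGroup_map_mem_dualLattice (inv_mem M'.2)
      (pointGroup_map_mem_dualLattice M.2 ν.2))) (mul_mem (inv_mem M.2) M'.2) h1
  have h4 : M = M' := Subtype.ext (inv_mul_eq_one.1 h3)
  subst h4
  rw [hs, sub_eq_zero] at h2
  refine ⟨rfl, Subtype.ext h2.symm, ?_⟩
  have := M.1.injective h
  rwa [h2, add_left_inj] at this

theorem injective_orbit (hω₀ : HasTrivialStabilizer Γ ω₀) {M M' : pointGroup Γ}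
    {ν ν' : dualLattice Γ} (h : M.1 (ω₀ + ν.1) = M'.1 (ω₀ + ν'.1)) : M = M' ∧ ν = ν' := by
  have hs : ∀ (z : Euc n), M.1⁻¹ (M.1 z) = z := fun z => M.1.symm_apply_apply z
  have hs' : ∀ (z : Euc n), M'.1 (M'.1⁻¹ z) = z := fun z => M'.1.apply_symm_apply z
  have h1 : (M.1⁻¹ * M'.1) (ω₀ + (ν'.1 - M'.1⁻¹ (M.1 ν.1))) = ω₀ := by
    rw [LinearIsometryEquiv.coe_mul, Function.comp_apply, ← add_sub_assoc, map_sub, ← h, hs',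
      ← map_sub, hs, add_sub_cancel_right]
  obtain ⟨h2, h3⟩ := hω₀ _ (sub_mem ν'.2 (pointGroup_map_mem_dualLattice (inv_mem M'.2)
      (pointGroup_map_mem_dualLattice M.2 ν.2))) _ (mul_mem (inv_mem M.2) M'.2) h1
  have h4 : M = M' := Subtype.ext (inv_mul_eq_one.1 h3)
  subst h4
  rw [hs, sub_eq_zero] at h2
  exact ⟨rfl, Subtype.ext h2.symm⟩

theorem exists_nearest_orbit_point (hΓ : IsCrystalGroup Γ) (hω₀ : HasTrivialStabilizer Γ ω₀)
    (ω : Euc n) : ∃ p : pointGroup Γ × dualLattice Γ, ∀ q : pointGroup Γ × dualLattice Γ,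
      ‖ω - p.1.1 (ω₀ + p.2.1)‖ ≤ ‖ω - q.1.1 (ω₀ + q.2.1)‖ := by
  have := finite_pointGroup hΓ hω₀
  set d : pointGroup Γ × dualLattice Γ → ℝ := fun p => ‖ω - p.1.1 (ω₀ + p.2.1)‖ with hd
  have hfin : {p | d p ≤ d (1, 0)}.Finite := by
    refine (Set.finite_univ.prod (finite_dualLattice_ball hΓ hω₀ (‖ω‖ + ‖ω₀‖ + d (1, 0)))).subset ?_
    rintro ⟨M, ν⟩ h
    refine ⟨Set.mem_univ _, ?_⟩
    have h1 : d (M, ν) ≤ d (1, 0) := h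
    have h2 : ‖M.1 (ω₀ + ν.1)‖ ≤ ‖ω‖ + d (M, ν) := by
      have := norm_sub_le ω (ω - M.1 (ω₀ + ν.1))
      rwa [sub_sub_cancel] at this
    have h3 : ‖ν.1‖ ≤ ‖ω₀ + ν.1‖ + ‖ω₀‖ := by
      have := norm_sub_le (ω₀ + ν.1) ω₀
      rwa [add_sub_cancel_left] at this
    rw [LinearIsometryEquiv.norm_map] at h2
    change ‖ν.1‖ ≤ _
    linarith
  obtain ⟨p, hp, hmin⟩ := hfin.exists_minimalFor d _ ⟨(1, 0), le_refl (d (1, 0))⟩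
  refine ⟨p, fun q => ?_⟩
  by_cases hq : d q ≤ d (1, 0)
  · exact (le_total (d p) (d q)).elim id (fun h => hmin hq h)
  · exact le_trans hp (not_le.1 hq).le

/-- The perpendicular bisectors of pairs of orbit points are countably many null hyperplanes. Off
them the nearest orbit point is unique, and the group element that produces it names the tile. -/
theorem ae_mem_tile (hΓ : IsCrystalGroup Γ) (hω₀ : HasTrivialStabilizer Γ ω₀) :
    ∀ᵐ ω : Euc n, ∃ (M : pointGroup Γ) (ν : dualLattice Γ), ∃ ω' ∈ dirichletDomain Γ ω₀,
      M.1 (ω' + ν.1) = ω := by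
  have := finite_pointGroup hΓ hω₀
  have := countable_dualLattice hΓ hω₀
  have hbis : ∀ a b : Euc n, a ≠ b → ∀ᵐ ω : Euc n, dist ω a ≠ dist ω b := by
    intro a b hab
    rw [ae_iff]
    have : {ω : Euc n | ¬ dist ω a ≠ dist ω b} = AffineSubspace.perpBisector a b := by
      ext ω
      simp [AffineSubspace.mem_perpBisector_iff_dist_eq]
    rw [this]
    exact Measure.addHaar_affineSubspace _ _ (by simpa using hab)
  have hall : ∀ᵐ ω : Euc n, ∀ p q : pointGroup Γ × dualLattice Γ,
      p.1.1 (ω₀ + p.2.1) ≠ q.1.1 (ω₀ + q.2.1) →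
      dist ω (p.1.1 (ω₀ + p.2.1)) ≠ dist ω (q.1.1 (ω₀ + q.2.1)) := by
    rw [ae_all_iff]; intro p
    rw [ae_all_iff]; intro q
    by_cases h : p.1.1 (ω₀ + p.2.1) = q.1.1 (ω₀ + q.2.1)
    · exact .of_forall fun ω hne => absurd h hne
    · filter_upwards [hbis _ _ h] with ω hω _ using hω
  filter_upwards [hall] with ω hω
  obtain ⟨⟨M, ν⟩, hp⟩ := exists_nearest_orbit_point hΓ hω₀ ω
  have hs : ∀ (z : Euc n), M.1 (M.1.symm z) = z := fun z => M.1.apply_symm_apply z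
  refine ⟨M, ν, M.1.symm ω - ν.1, ?_, by rw [sub_add_cancel, hs]⟩
  intro μ hμ N hN hne
  -- The product of `(ν, M)` and `(μ, N)` in the semidirect product: `M(N(ω₀ + μ) + ν) = MN(ω₀ + μ +
  -- N⁻¹ν)`.
  let q : pointGroup Γ × dualLattice Γ := (M * ⟨N, hN⟩, ⟨μ + N⁻¹ ν.1,
    add_mem hμ (pointGroup_map_mem_dualLattice (inv_mem hN) ν.2)⟩)
  have e1 : ‖M.1.symm ω - ν.1 - ω₀‖ = ‖ω - M.1 (ω₀ + ν.1)‖ := by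
    rw [← M.1.norm_map, map_sub, map_sub, hs, map_add]
    congr 1; abel
  have e2 : ‖M.1.symm ω - ν.1 - N (ω₀ + μ)‖ = ‖ω - q.1.1 (ω₀ + q.2.1)‖ := by
    have : q.1.1 (ω₀ + q.2.1) = M.1 (N (ω₀ + μ) + ν.1) := by
      change M.1 (N (ω₀ + (μ + N⁻¹ ν.1))) = _
      rw [← add_assoc, map_add N]
      congr 2
      exact N.apply_symm_apply _
    rw [this, ← M.1.norm_map, map_sub, map_sub, hs,
      map_add M.1 (N (ω₀ + μ)) ν.1, sub_sub, add_comm]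
  rw [e1, e2]
  refine lt_of_le_of_ne (hp q) ?_
  have hpq := hω (M, ν) q
  rw [dist_eq_norm, dist_eq_norm] at hpq
  refine hpq fun h => hne ?_
  obtain ⟨h1, h2⟩ := injective_orbit hω₀ h
  have hN1 : N = 1 := congrArg Subtype.val (left_eq_mul.1 h1)
  have h3 : ν.1 = μ + N⁻¹ ν.1 := congrArg Subtype.val h2
  refine ⟨?_, hN1⟩
  rw [hN1, inv_one] at h3
  exact right_eq_add.1 h3

theorem measurableSet_dirichletDomain (hΓ : IsCrystalGroup Γ) (hω₀ : HasTrivialStabilizer Γ ω₀) :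
    MeasurableSet (dirichletDomain Γ ω₀) := by
  have := finite_pointGroup hΓ hω₀
  have := countable_dualLattice hΓ hω₀
  have : dirichletDomain Γ ω₀ = ⋂ (ν : dualLattice Γ) (M : pointGroup Γ),
      {ω | ¬(ν.1 = 0 ∧ M.1 = 1) → ‖ω - ω₀‖ < ‖ω - M.1 (ω₀ + ν.1)‖} := by
    ext ω
    simp only [dirichletDomain, Set.mem_iInter, Set.mem_ofPred_eq]
    exact ⟨fun h ν M => h ν.1 ν.2 M.1 M.2, fun h ν hν M hM => h ⟨ν, hν⟩ ⟨M, hM⟩⟩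
  rw [this]
  refine MeasurableSet.iInter fun ν => MeasurableSet.iInter fun M => ?_
  by_cases h : ν.1 = 0 ∧ M.1 = 1
  · simp [h]
  · simp only [h, not_false_eq_true, forall_true_left]
    exact measurableSet_lt (by fun_prop) (by fun_prop)

end CrystalShift
end

/-! ### Decomposition of Lebesgue measure along the tiles. -/

noncomputable section
namespace CrystalShift

variable {n : ℕ} {Γ : Subgroup (Iso n)} {ω₀ : Euc n}

theorem restrict_iUnion_image_eq_sum {ι : Type*} [Countable ι] {S : Set (Euc n)}
    (hS : MeasurableSet S) {φ : ι → Euc n → Euc n} (hφ : ∀ i, MeasurePreserving (φ i) volume volume)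
    (hemb : ∀ i, MeasurableEmbedding (φ i))
    (hinj : ∀ i j, ∀ x ∈ S, ∀ y ∈ S, φ i x = φ j y → i = j) :
    volume.restrict (⋃ i, φ i '' S) =
      Measure.sum fun i => (restrictedVolume S).map fun x : S => φ i x.1 := by
  rw [Measure.restrict_iUnion]
  · congr 1
    funext i
    rw [← ((hφ i).restrict_image_emb (hemb i) S).map_eq, ← map_comap_subtype_coe hS,
      Measure.map_map (hemb i).measurable measurable_subtype_coe]
    rfl
  · intro i j hij
    rw [Function.onFun, Set.disjoint_left]
    rintro _ ⟨x, hx, rfl⟩ ⟨y, hy, e⟩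
    exact hij (hinj i j x hx y hy e.symm)
  · exact fun i => (hemb i).measurableSet_image.2 hS

theorem measurableEmbedding_tile (M : Euc n ≃ₗᵢ[ℝ] Euc n) (ν : Euc n) :
    MeasurableEmbedding fun z => M (z + ν) :=
  M.toHomeomorph.measurableEmbedding.comp (measurableEmbedding_addRight ν)

theorem measurePreserving_tile (M : Euc n ≃ₗᵢ[ℝ] Euc n) (ν : Euc n) :
    MeasurePreserving (fun z => M (z + ν)) volume volume :=
  M.measurePreserving.comp (measurePreserving_add_right volume ν)

theorem volume_eq_sum_map_tile (hΓ : IsCrystalGroup Γ) (hω₀ : HasTrivialStabilizer Γ ω₀) :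
    (volume : Measure (Euc n)) = Measure.sum fun p : pointGroup Γ × dualLattice Γ =>
      (restrictedVolume (dirichletDomain Γ ω₀)).map fun ω => p.1.1 (ω.1 + p.2.1) := by
  have := finite_pointGroup hΓ hω₀
  have := countable_dualLattice hΓ hω₀
  rw [← restrict_iUnion_image_eq_sum (measurableSet_dirichletDomain hΓ hω₀)
    (φ := fun (p : pointGroup Γ × dualLattice Γ) (z : Euc n) => p.1.1 (z + p.2.1))
    (fun p => measurePreserving_tile _ _)
    (fun p => measurableEmbedding_tile _ _) (fun p q x hx y hy h => by
      obtain ⟨h1, h2, -⟩ := injective_tile hx hy h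
      exact Prod.ext h1 h2), Measure.restrict_eq_self_of_ae_mem]
  filter_upwards [ae_mem_tile hΓ hω₀] with ω ⟨M, ν, ω', h, e⟩
  exact Set.mem_iUnion.2 ⟨(M, ν), ω', h, e⟩

theorem pointOrbit_eq_iUnion :
    pointOrbit Γ ω₀ = ⋃ L : pointGroup Γ, (fun z => L.1 z) '' dirichletDomain Γ ω₀ := by
  ext θ
  simp only [pointOrbit, Set.mem_ofPred_eq, Set.mem_iUnion, Set.mem_image, Subtype.exists,
    exists_prop]

theorem injective_domToOrbit {L L' : pointGroup Γ} {ω ω' : dirichletDomain Γ ω₀}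
    (h : domToOrbit L ω = domToOrbit L' ω') : L = L' ∧ ω = ω' := by
  have h1 : L.1 (ω.1 + (0 : dualLattice Γ).1) = L'.1 (ω'.1 + (0 : dualLattice Γ).1) := by
    simpa [domToOrbit] using congrArg Subtype.val h
  obtain ⟨h2, -, h3⟩ := injective_tile ω.2 ω'.2 h1
  exact ⟨h2, Subtype.ext h3⟩

theorem exists_domToOrbit_eq (θ : pointOrbit Γ ω₀) :
    ∃ (L : pointGroup Γ) (ω : dirichletDomain Γ ω₀), domToOrbit L ω = θ := by
  obtain ⟨M, hM, ω, hω, h⟩ := θ.2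
  exact ⟨⟨M, hM⟩, ⟨ω, hω⟩, Subtype.ext h⟩

theorem measurableSet_pointOrbit (hΓ : IsCrystalGroup Γ) (hω₀ : HasTrivialStabilizer Γ ω₀) :
    MeasurableSet (pointOrbit Γ ω₀) := by
  have := finite_pointGroup hΓ hω₀
  rw [pointOrbit_eq_iUnion]
  exact MeasurableSet.iUnion fun L => L.1.toHomeomorph.measurableEmbedding.measurableSet_image.2
    (measurableSet_dirichletDomain hΓ hω₀)

theorem measurableEmbedding_domToOrbit (hΓ : IsCrystalGroup Γ) (hω₀ : HasTrivialStabilizer Γ ω₀)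
    (L : pointGroup Γ) : MeasurableEmbedding (domToOrbit L : dirichletDomain Γ ω₀ → _) := by
  -- On a standard Borel space an injective measurable map is an embedding (Lusin–Souslin).
  have := (measurableSet_dirichletDomain hΓ hω₀).standardBorel
  refine Measurable.measurableEmbedding ?_ fun ω ω' h => (injective_domToOrbit h).2
  exact (L.1.continuous.measurable.comp measurable_subtype_coe).subtype_mk

theorem restrictedVolume_pointOrbit_eq_sum (hΓ : IsCrystalGroup Γ)
    (hω₀ : HasTrivialStabilizer Γ ω₀) :
    restrictedVolume (pointOrbit Γ ω₀) = Measure.sum fun L : pointGroup Γ =>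
      (restrictedVolume (dirichletDomain Γ ω₀)).map (domToOrbit L) := by
  have := finite_pointGroup hΓ hω₀
  have hO := measurableSet_pointOrbit hΓ hω₀
  have key := restrict_iUnion_image_eq_sum (measurableSet_dirichletDomain hΓ hω₀)
    (φ := fun (L : pointGroup Γ) (z : Euc n) => L.1 z) (fun L => L.1.measurePreserving)
    (fun L => L.1.toHomeomorph.measurableEmbedding) (fun L L' x hx y hy h =>
      (injective_domToOrbit (ω := ⟨x, hx⟩) (ω' := ⟨y, hy⟩) (Subtype.ext h)).1)
  rw [← pointOrbit_eq_iUnion] at key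
  ext s hs
  have hs' := (MeasurableEmbedding.subtype_coe hO).measurableSet_image.2 hs
  rw [restrictedVolume, comap_subtype_coe_apply hO, Measure.sum_apply _ hs,
    ← Measure.restrict_eq_self volume (Subtype.coe_image_subset _ s), key, Measure.sum_apply _ hs']
  congr 1
  funext L
  rw [Measure.map_apply (measurableEmbedding_domToOrbit hΓ hω₀ L).measurable hs,
    Measure.map_apply (show Measurable fun ω : dirichletDomain Γ ω₀ => L.1 ω.1 from
      L.1.continuous.measurable.comp measurable_subtype_coe) hs']
  congr 1
  ext ω
  constructor
  · rintro ⟨θ, hθ, e⟩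
    have : θ = domToOrbit L ω := Subtype.ext e
    exact (show domToOrbit L ω ∈ s from this ▸ hθ)
  · exact fun h => ⟨_, h, rfl⟩

theorem ae_pointOrbit_iff (hΓ : IsCrystalGroup Γ) (hω₀ : HasTrivialStabilizer Γ ω₀)
    {p : pointOrbit Γ ω₀ → Prop} :
    (∀ᵐ θ ∂restrictedVolume (pointOrbit Γ ω₀), p θ) ↔
      ∀ᵐ ω ∂restrictedVolume (dirichletDomain Γ ω₀), ∀ L : pointGroup Γ, p (domToOrbit L ω) := by
  have := finite_pointGroup hΓ hω₀
  rw [restrictedVolume_pointOrbit_eq_sum hΓ hω₀, Measure.ae_sum_iff, ae_all_iff]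
  exact forall_congr' fun L => (measurableEmbedding_domToOrbit hΓ hω₀ L).ae_map_iff

theorem ae_dirichletDomain_of_ae (hΓ : IsCrystalGroup Γ) (hω₀ : HasTrivialStabilizer Γ ω₀)
    {p : Euc n → Prop} (h : ∀ᵐ ω, p ω) :
    ∀ᵐ ω ∂restrictedVolume (dirichletDomain Γ ω₀), ∀ (L : pointGroup Γ) (ν : dualLattice Γ),
      p (L.1 (ω.1 + ν.1)) := by
  have := finite_pointGroup hΓ hω₀
  have := countable_dualLattice hΓ hω₀
  rw [volume_eq_sum_map_tile hΓ hω₀, Measure.ae_sum_iff] at h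
  rw [ae_all_iff]; intro L
  rw [ae_all_iff]; intro ν
  exact ae_of_ae_map ((measurableEmbedding_tile L.1 ν.1).measurable.comp
    measurable_subtype_coe).aemeasurable (h (L, ν))

theorem lintegral_eq_tsum_tile (hΓ : IsCrystalGroup Γ) (hω₀ : HasTrivialStabilizer Γ ω₀)
    (u : Euc n → ℝ≥0∞) :
    ∫⁻ z, u z = ∑' (L : pointGroup Γ) (ν : dualLattice Γ),
      ∫⁻ ω, u (L.1 (ω.1 + ν.1)) ∂restrictedVolume (dirichletDomain Γ ω₀) := by
  rw [volume_eq_sum_map_tile hΓ hω₀, lintegral_sum_measure, ENNReal.tsum_prod']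
  refine tsum_congr fun L => tsum_congr fun ν => ?_
  exact ((measurableEmbedding_tile L.1 ν.1).comp (MeasurableEmbedding.subtype_coe
    (measurableSet_dirichletDomain hΓ hω₀))).lintegral_map _

theorem lintegral_pointOrbit_eq_tsum (hΓ : IsCrystalGroup Γ) (hω₀ : HasTrivialStabilizer Γ ω₀)
    (u : pointOrbit Γ ω₀ → ℝ≥0∞) :
    ∫⁻ θ, u θ ∂restrictedVolume (pointOrbit Γ ω₀) = ∑' L : pointGroup Γ,
      ∫⁻ ω, u (domToOrbit L ω) ∂restrictedVolume (dirichletDomain Γ ω₀) := by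
  rw [restrictedVolume_pointOrbit_eq_sum hΓ hω₀, lintegral_sum_measure]
  exact tsum_congr fun L => (measurableEmbedding_domToOrbit hΓ hω₀ L).lintegral_map _

theorem aestronglyMeasurable_pointOrbit_iff (hΓ : IsCrystalGroup Γ)
    (hω₀ : HasTrivialStabilizer Γ ω₀) {E : Type*} [TopologicalSpace E]
    [TopologicalSpace.PseudoMetrizableSpace E] {u : pointOrbit Γ ω₀ → E} :
    AEStronglyMeasurable u (restrictedVolume (pointOrbit Γ ω₀)) ↔ ∀ L : pointGroup Γ,
      AEStronglyMeasurable (fun ω => u (domToOrbit L ω))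
        (restrictedVolume (dirichletDomain Γ ω₀)) := by
  have := finite_pointGroup hΓ hω₀
  rw [restrictedVolume_pointOrbit_eq_sum hΓ hω₀, aestronglyMeasurable_sum_measure_iff]
  exact forall_congr' fun L =>
    (measurableEmbedding_domToOrbit hΓ hω₀ L).aestronglyMeasurable_map_iff

theorem orbitAct_domToOrbit (L M : pointGroup Γ) (ω : dirichletDomain Γ ω₀) :
    orbitAct L (domToOrbit M ω) = domToOrbit (L * M) ω := rfl

theorem ae_orbitAct (hΓ : IsCrystalGroup Γ) (hω₀ : HasTrivialStabilizer Γ ω₀)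
    {p : pointOrbit Γ ω₀ → Prop} (h : ∀ᵐ θ ∂restrictedVolume (pointOrbit Γ ω₀), p θ)
    (M : pointGroup Γ) : ∀ᵐ θ ∂restrictedVolume (pointOrbit Γ ω₀), p (orbitAct M θ) := by
  rw [ae_pointOrbit_iff hΓ hω₀] at h ⊢
  filter_upwards [h] with ω hω L
  rw [orbitAct_domToOrbit]
  exact hω _

end CrystalShift
end

/-! ### The fiber transform and its intertwining property. -/

noncomputable section
namespace CrystalShift

variable {n : ℕ} {Γ : Subgroup (Iso n)} {ω₀ : Euc n}

theorem inner_delta (ν : dualLattice Γ) (ξ : EllTwo Γ) : inner ℂ (delta ν) ξ = ξ ν := by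
  classical
  have := lp.inner_single_left (𝕜 := ℂ) (G := fun _ : dualLattice Γ => ℂ) ν 1 ξ
  rw [delta]
  convert this using 1
  simp

theorem ellTwo_smul_apply (c : ℂ) (ξ : EllTwo Γ) (ν : dualLattice Γ) : (c • ξ) ν = c * ξ ν := rfl

theorem isFiberTransform_iff {x : pointGroup Γ → Euc n} {f : LTwo n}
    {F : Lp (EllTwo Γ) 2 (restrictedVolume (pointOrbit Γ ω₀))} :
    IsFiberTransform x f F ↔ ∀ᵐ ω ∂restrictedVolume (dirichletDomain Γ ω₀),
      ∀ (L : pointGroup Γ) (ν : dualLattice Γ),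
        hat f (L.1 (ω.1 + ν.1)) = phase (x L) ν.1 * (F (domToOrbit L ω) : EllTwo Γ) ν := by
  simp only [IsFiberTransform, inner_delta, phase]

theorem enorm_sq_eq_tsum {ι : Type*} (ξ : lp (fun _ : ι => ℂ) 2) :
    ‖ξ‖ₑ ^ 2 = ∑' i, ‖ξ i‖ₑ ^ 2 := by
  have h := lp.hasSum_norm (p := 2) (by norm_num) ξ
  simp only [ENNReal.toReal_ofNat, Real.rpow_two] at h
  have h2 := h.tsum_eq
  rw [← ofReal_norm, ← ENNReal.ofReal_pow (norm_nonneg _), ← h2,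
    ENNReal.ofReal_tsum_of_nonneg (fun _ => by positivity) h.summable]
  exact tsum_congr fun i => by rw [ENNReal.ofReal_pow (norm_nonneg _), ofReal_norm]

theorem memℓp_two_of_tsum_ne_top {ι : Type*} {u : ι → ℂ} (h : ∑' i, ‖u i‖ₑ ^ 2 ≠ ∞) :
    Memℓp u 2 := by
  refine memℓp_gen ?_
  simp only [ENNReal.toReal_ofNat, Real.rpow_two]
  refine (ENNReal.summable_toReal h).congr fun i => ?_
  rw [ENNReal.toReal_pow, toReal_enorm]

theorem aestronglyMeasurable_lp_two {ι X : Type*} [Countable ι] [MeasurableSpace X] {μ : Measure X}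
    {u : X → lp (fun _ : ι => ℂ) 2} (h : ∀ i, AEStronglyMeasurable (fun x => u x i) μ) :
    AEStronglyMeasurable u μ := by
  classical
  refine aestronglyMeasurable_of_tendsto_ae Filter.atTop
    (f := fun (s : Finset ι) x => ∑ i ∈ s, lp.single (E := fun _ : ι => ℂ) 2 i (u x i)) (fun s => ?_)
    (.of_forall fun x => lp.hasSum_single (by norm_num) (u x))
  refine Finset.aestronglyMeasurable_fun_sum s fun i _ => ?_
  have : ∀ x, lp.single (E := fun _ : ι => ℂ) 2 i (u x i) = u x i • lp.single (E := fun _ : ι => ℂ) 2 i (1 : ℂ) := by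
    intro x
    rw [← lp.single_smul, smul_eq_mul, mul_one]
  simp only [this]
  exact (h i).smul_const _

theorem eLpNorm_two_eq {X E : Type*} [MeasurableSpace X] [NormedAddCommGroup E] (μ : Measure X)
    (u : X → E) : eLpNorm u 2 μ = (∫⁻ x, ‖u x‖ₑ ^ 2 ∂μ) ^ (1 / 2 : ℝ) := by
  rw [eLpNorm_eq_lintegral_rpow_enorm_toReal (by norm_num) (by norm_num)]
  simp

/-- Parseval along the tiling: the phases are unimodular, and summing over `ν` inside the integral
gives the squared `ℓ²` norm of the fiber. -/
theorem lintegral_enorm_sq_fiber (hΓ : IsCrystalGroup Γ) (hω₀ : HasTrivialStabilizer Γ ω₀)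
    {x : pointGroup Γ → Euc n} {h : Euc n → ℂ} (hh : Measurable h)
    {G : pointOrbit Γ ω₀ → EllTwo Γ}
    (hG : ∀ᵐ ω ∂restrictedVolume (dirichletDomain Γ ω₀),
      ∀ (L : pointGroup Γ) (ν : dualLattice Γ),
        h (L.1 (ω.1 + ν.1)) = phase (x L) ν.1 * G (domToOrbit L ω) ν) :
    ∫⁻ θ, ‖G θ‖ₑ ^ 2 ∂restrictedVolume (pointOrbit Γ ω₀) = ∫⁻ z, ‖h z‖ₑ ^ 2 := by
  have := countable_dualLattice hΓ hω₀
  rw [lintegral_pointOrbit_eq_tsum hΓ hω₀, lintegral_eq_tsum_tile hΓ hω₀]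
  refine tsum_congr fun L => ?_
  have hm : ∀ ν : dualLattice Γ, AEMeasurable (fun ω : dirichletDomain Γ ω₀ =>
      ‖h (L.1 (ω.1 + ν.1))‖ₑ ^ 2) (restrictedVolume (dirichletDomain Γ ω₀)) := fun ν =>
    ((hh.comp ((measurableEmbedding_tile L.1 ν.1).measurable.comp
      measurable_subtype_coe)).enorm.pow_const 2).aemeasurable
  rw [← lintegral_tsum hm]
  refine lintegral_congr_ae ?_
  filter_upwards [hG] with ω hω
  rw [enorm_sq_eq_tsum]
  refine tsum_congr fun ν => ?_
  have : ‖phase (x L) ν.1‖ₑ = 1 := by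
    rw [← ofReal_norm, norm_phase, ENNReal.ofReal_one]
  rw [hω L ν, enorm_mul, this, one_mul]

theorem exists_isFiberTransform (hΓ : IsCrystalGroup Γ) (hω₀ : HasTrivialStabilizer Γ ω₀)
    (x : pointGroup Γ → Euc n) (f : LTwo n) :
    ∃ F : Lp (EllTwo Γ) 2 (restrictedVolume (pointOrbit Γ ω₀)), IsFiberTransform x f F := by
  classical
  have := finite_pointGroup hΓ hω₀
  have := countable_dualLattice hΓ hω₀
  obtain ⟨h, hdef⟩ : ∃ h : Euc n → ℂ, h = ⇑(hat f) := ⟨_, rfl⟩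
  have hh : Measurable h := hdef ▸ (Lp.stronglyMeasurable (hat f)).measurable
  have hfin : ∫⁻ z, ‖h z‖ₑ ^ 2 ≠ ∞ := by
    have := (Lp.memLp (hat f)).eLpNorm_ne_top
    rw [← hdef, eLpNorm_two_eq] at this
    intro h'
    rw [h'] at this
    simp at this
  let u : pointGroup Γ → dirichletDomain Γ ω₀ → dualLattice Γ → ℂ := fun L ω ν =>
    (phase (x L) ν.1)⁻¹ * h (L.1 (ω.1 + ν.1))
  have hu : ∀ L ν, Measurable fun ω => u L ω ν := fun L ν =>
    (hh.comp ((measurableEmbedding_tile L.1 ν.1).measurable.comp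
      measurable_subtype_coe)).const_mul _
  have hun : ∀ L ω ν, ‖u L ω ν‖ₑ = ‖h (L.1 (ω.1 + ν.1))‖ₑ := by
    intro L ω ν
    have : ‖(phase (x L) ν.1)⁻¹‖ₑ = 1 := by
      rw [← ofReal_norm, norm_inv, norm_phase, inv_one, ENNReal.ofReal_one]
    rw [enorm_mul, this, one_mul]
  -- The sum over `ν` has finite integral, so it is finite almost everywhere; on the exceptional
  -- null set the fiber is set to `0`.
  have hmem : ∀ᵐ ω ∂restrictedVolume (dirichletDomain Γ ω₀), ∀ L, Memℓp (u L ω) 2 := by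
    rw [ae_all_iff]; intro L
    have h1 : ∫⁻ ω, ∑' ν, ‖u L ω ν‖ₑ ^ 2 ∂restrictedVolume (dirichletDomain Γ ω₀) ≠ ∞ := by
      rw [lintegral_tsum fun ν => ((hu L ν).enorm.pow_const 2).aemeasurable]
      rw [lintegral_eq_tsum_tile hΓ hω₀] at hfin
      simp only [hun]
      exact ne_top_of_le_ne_top hfin (ENNReal.le_tsum (f := fun L : pointGroup Γ =>
        ∑' ν : dualLattice Γ, ∫⁻ ω, ‖h (L.1 (ω.1 + ν.1))‖ₑ ^ 2
          ∂restrictedVolume (dirichletDomain Γ ω₀)) L)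
    filter_upwards [ae_lt_top' (AEMeasurable.tsum fun ν =>
      ((hu L ν).enorm.pow_const 2).aemeasurable) h1] with ω hω
    exact memℓp_two_of_tsum_ne_top hω.ne
  let G' : pointGroup Γ → dirichletDomain Γ ω₀ → EllTwo Γ := fun L ω =>
    if h : Memℓp (u L ω) 2 then ⟨u L ω, h⟩ else 0
  choose l o hlo using fun θ : pointOrbit Γ ω₀ => exists_domToOrbit_eq θ
  let G : pointOrbit Γ ω₀ → EllTwo Γ := fun θ => G' (l θ) (o θ)
  have hG : ∀ L ω, G (domToOrbit L ω) = G' L ω := by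
    intro L ω
    obtain ⟨h1, h2⟩ := injective_domToOrbit (hlo (domToOrbit L ω))
    simp only [G, h1, h2]
  have hG' : ∀ᵐ ω ∂restrictedVolume (dirichletDomain Γ ω₀), ∀ (L : pointGroup Γ)
      (ν : dualLattice Γ), G (domToOrbit L ω) ν = u L ω ν := by
    filter_upwards [hmem] with ω hω L ν
    rw [hG]
    simp only [G', dif_pos (hω L)]
  have hGu : ∀ᵐ ω ∂restrictedVolume (dirichletDomain Γ ω₀), ∀ (L : pointGroup Γ)
      (ν : dualLattice Γ), h (L.1 (ω.1 + ν.1)) = phase (x L) ν.1 * G (domToOrbit L ω) ν := by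
    filter_upwards [hG'] with ω hω L ν
    rw [hω, mul_inv_cancel_left₀ (phase_ne_zero _ _)]
  have hmeas : AEStronglyMeasurable G (restrictedVolume (pointOrbit Γ ω₀)) := by
    rw [aestronglyMeasurable_pointOrbit_iff hΓ hω₀]
    intro L
    refine aestronglyMeasurable_lp_two fun ν => (hu L ν).aestronglyMeasurable.congr ?_
    filter_upwards [hG'] with ω hω
    exact (hω L ν).symm
  have hLp : MemLp G 2 (restrictedVolume (pointOrbit Γ ω₀)) := by
    refine ⟨hmeas, ?_⟩
    rw [eLpNorm_two_eq, lintegral_enorm_sq_fiber hΓ hω₀ hh hGu]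
    exact ENNReal.rpow_lt_top_of_nonneg (by norm_num) hfin
  refine ⟨hLp.toLp, isFiberTransform_iff.2 ?_⟩
  filter_upwards [hGu, (ae_pointOrbit_iff hΓ hω₀).1 hLp.coeFn_toLp] with ω h1 h2 L ν
  rw [h2 L, ← hdef]
  exact h1 L ν

theorem IsFiberTransform.norm_eq (hΓ : IsCrystalGroup Γ) (hω₀ : HasTrivialStabilizer Γ ω₀)
    {x : pointGroup Γ → Euc n} {f : LTwo n}
    {F : Lp (EllTwo Γ) 2 (restrictedVolume (pointOrbit Γ ω₀))} (h : IsFiberTransform x f F) :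
    ‖F‖ = ‖f‖ := by
  have h1 : ‖hat f‖ = ‖f‖ := (Lp.fourierTransformₗᵢ (Euc n) ℂ).symm.norm_map f
  rw [← h1, Lp.norm_def, Lp.norm_def, eLpNorm_two_eq, eLpNorm_two_eq,
    lintegral_enorm_sq_fiber hΓ hω₀ (Lp.stronglyMeasurable (hat f)).measurable
      (isFiberTransform_iff.1 h)]

theorem hat_add (f g : LTwo n) : hat (f + g) = hat f + hat g :=
  (Lp.fourierTransformₗᵢ (Euc n) ℂ).symm.map_add f g

theorem hat_smul (c : ℂ) (f : LTwo n) : hat (c • f) = c • hat f :=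
  (Lp.fourierTransformₗᵢ (Euc n) ℂ).symm.map_smul c f

theorem IsFiberTransform.add (hΓ : IsCrystalGroup Γ) (hω₀ : HasTrivialStabilizer Γ ω₀)
    {x : pointGroup Γ → Euc n} {f g : LTwo n}
    {F G : Lp (EllTwo Γ) 2 (restrictedVolume (pointOrbit Γ ω₀))} (hF : IsFiberTransform x f F)
    (hG : IsFiberTransform x g G) : IsFiberTransform x (f + g) (F + G) := by
  rw [isFiberTransform_iff] at *
  filter_upwards [hF, hG, (ae_pointOrbit_iff hΓ hω₀).1 (Lp.coeFn_add F G),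
    ae_dirichletDomain_of_ae hΓ hω₀ (Lp.coeFn_add (hat f) (hat g))] with ω h1 h2 h3 h4 L ν
  rw [hat_add, h4 L ν, h3 L, Pi.add_apply, Pi.add_apply, h1, h2, lp.coeFn_add, Pi.add_apply,
    mul_add]

theorem IsFiberTransform.smul (hΓ : IsCrystalGroup Γ) (hω₀ : HasTrivialStabilizer Γ ω₀)
    {x : pointGroup Γ → Euc n} {f : LTwo n} (c : ℂ)
    {F : Lp (EllTwo Γ) 2 (restrictedVolume (pointOrbit Γ ω₀))} (hF : IsFiberTransform x f F) :
    IsFiberTransform x (c • f) (c • F) := by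
  rw [isFiberTransform_iff] at *
  filter_upwards [hF, (ae_pointOrbit_iff hΓ hω₀).1 (Lp.coeFn_smul c F),
    ae_dirichletDomain_of_ae hΓ hω₀ (Lp.coeFn_smul c (hat f))] with ω h1 h3 h4 L ν
  rw [hat_smul, h4 L ν, h3 L, Pi.smul_apply, Pi.smul_apply, h1, lp.coeFn_smul, Pi.smul_apply,
    smul_eq_mul, smul_eq_mul, mul_left_comm]

/-- By linearity `F - G` is a transform of `0`, so its norm vanishes. -/
theorem IsFiberTransform.unique (hΓ : IsCrystalGroup Γ) (hω₀ : HasTrivialStabilizer Γ ω₀)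
    {x : pointGroup Γ → Euc n} {f : LTwo n}
    {F G : Lp (EllTwo Γ) 2 (restrictedVolume (pointOrbit Γ ω₀))} (hF : IsFiberTransform x f F)
    (hG : IsFiberTransform x f G) : F = G := by
  have h := (hF.add hΓ hω₀ (hG.smul hΓ hω₀ (-1))).norm_eq hΓ hω₀
  rw [neg_one_smul, neg_one_smul, add_neg_cancel, norm_zero, norm_eq_zero,
    ← sub_eq_add_neg] at h
  exact sub_eq_zero.1 h

/-- The isometry which sends `f` to the function `F` with
`f̂(L(ω + ν)) = e^{2πi ν·x_L} ⟨F(Lω), δ_ν⟩`. -/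
def fiberTransform (hΓ : IsCrystalGroup Γ) (hω₀ : HasTrivialStabilizer Γ ω₀)
    (x : pointGroup Γ → Euc n) :
    LTwo n →ₗᵢ[ℂ] Lp (EllTwo Γ) 2 (restrictedVolume (pointOrbit Γ ω₀)) where
  toFun f := (exists_isFiberTransform hΓ hω₀ x f).choose
  map_add' f g := (exists_isFiberTransform hΓ hω₀ x (f + g)).choose_spec.unique hΓ hω₀
    ((exists_isFiberTransform hΓ hω₀ x f).choose_spec.add hΓ hω₀
      (exists_isFiberTransform hΓ hω₀ x g).choose_spec)
  map_smul' c f := (exists_isFiberTransform hΓ hω₀ x (c • f)).choose_spec.unique hΓ hω₀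
    ((exists_isFiberTransform hΓ hω₀ x f).choose_spec.smul hΓ hω₀ c)
  norm_map' f := (exists_isFiberTransform hΓ hω₀ x f).choose_spec.norm_eq hΓ hω₀

theorem isFiberTransform_fiberTransform (hΓ : IsCrystalGroup Γ) (hω₀ : HasTrivialStabilizer Γ ω₀)
    (x : pointGroup Γ → Euc n) (f : LTwo n) :
    IsFiberTransform x f (fiberTransform hΓ hω₀ x f) :=
  (exists_isFiberTransform hΓ hω₀ x f).choose_spec

theorem isFiberTransform_iff_eq (hΓ : IsCrystalGroup Γ) (hω₀ : HasTrivialStabilizer Γ ω₀)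
    {x : pointGroup Γ → Euc n} {f : LTwo n}
    {F : Lp (EllTwo Γ) 2 (restrictedVolume (pointOrbit Γ ω₀))} :
    IsFiberTransform x f F ↔ F = fiberTransform hΓ hω₀ x f :=
  ⟨fun h => h.unique hΓ hω₀ (isFiberTransform_fiberTransform hΓ hω₀ x f),
    fun h => h ▸ isFiberTransform_fiberTransform hΓ hω₀ x f⟩

/-- The fiber transform turns the shift by `g = [x, A]` into
`F ↦ e^{2πi θ·(A x)} F(A⁻¹ θ)`. -/
theorem fiberTransform_shift (hΓ : IsCrystalGroup Γ) (hω₀ : HasTrivialStabilizer Γ ω₀)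
    (γ : pointGroup Γ → Γ) (hγ : ∀ M : pointGroup Γ, linPart (γ M : Iso n) = M)
    (f : LTwo n) {g : Iso n} (hg : g ∈ Γ) (A : pointGroup Γ) (hA : A.1 = linPart g) :
    ∀ᵐ θ ∂restrictedVolume (pointOrbit Γ ω₀),
      fiberTransform hΓ hω₀ (fun L => shiftPart (γ L : Iso n)) (shift g f) θ =
        phase (g 0) θ.1 • fiberTransform hΓ hω₀ (fun L => shiftPart (γ L : Iso n)) f
          (orbitAct A⁻¹ θ) := by
  rw [ae_pointOrbit_iff hΓ hω₀]
  filter_upwards [isFiberTransform_iff.1 (isFiberTransform_fiberTransform hΓ hω₀ _ f),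
    isFiberTransform_iff.1 (isFiberTransform_fiberTransform hΓ hω₀ _ (shift g f)),
    ae_dirichletDomain_of_ae hΓ hω₀ (hat_shift g f)] with ω h1 h2 h3 L
  ext ν
  have h4 := h2 L ν
  rw [h3 L ν] at h4
  have h5 : (linPart g).symm (L.1 (ω.1 + ν.1)) = (A⁻¹ * L).1 (ω.1 + ν.1) := by
    rw [← hA]; rfl
  rw [h5, h1 (A⁻¹ * L) ν, map_add, phase_add_right] at h4
  rw [orbitAct_domToOrbit, ellTwo_smul_apply]
  -- The cocycle identity behind the factors `e^{2πi ν·x_L}`: `g γ(A⁻¹L)` and `γ(L)` both have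
  -- linear part `L`, so their shift parts `x_{A⁻¹L} + L⁻¹ g(0)` and `x_L` differ by a lattice
  -- vector, on which every dual vector `ν` has phase `1`. Hence the dependence on `ν` cancels.
  have e1 : linPart (g * (γ (A⁻¹ * L)).1) = linPart (γ L).1 := by
    rw [linPart_mul, hγ, hγ, ← hA]
    exact congrArg Subtype.val (mul_inv_cancel_left A L)
  have e2 : shiftPart (g * (γ (A⁻¹ * L)).1) = shiftPart (γ (A⁻¹ * L)).1 + L.1.symm (g 0) := by
    apply (linPart (g * (γ (A⁻¹ * L)).1)).injective
    have e3 : ∀ h : Iso n, linPart h (shiftPart h) = h 0 := fun h => by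
      rw [shiftPart, LinearIsometryEquiv.apply_symm_apply]
    rw [e3, map_add, linPart_mul, LinearIsometryEquiv.coe_mul, Function.comp_apply, e3,
      ← LinearIsometryEquiv.coe_mul, ← linPart_mul, e1, hγ, LinearIsometryEquiv.apply_symm_apply,
      AffineIsometryEquiv.coe_mul, Function.comp_apply, ← iso_map_add, add_zero]
  have e4 := shiftPart_sub_mem_lattice (Γ.mul_mem hg (γ (A⁻¹ * L)).2) (γ L).2 e1
  obtain ⟨m, hm⟩ := ν.2 _ e4
  have e5 : phase (shiftPart (g * (γ (A⁻¹ * L)).1) - shiftPart (γ L).1) ν.1 = 1 := by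
    rw [phase, hm, Complex.exp_eq_one_iff]
    exact ⟨m, by push_cast; ring⟩
  have e6 : phase (shiftPart (γ (A⁻¹ * L)).1) ν.1 * phase (g 0) (L.1 ν.1)
      = phase (shiftPart (γ L).1) ν.1 := by
    rw [← one_mul (phase (shiftPart (γ L).1) ν.1), ← e5, ← phase_add_left, sub_add_cancel, e2,
      phase_add_left]
    congr 1
    simpa using phase_map_symm L.1.symm (g 0) ν.1
  refine mul_left_cancel₀ (phase_ne_zero (shiftPart (γ L).1) ν.1) ?_
  rw [← h4, ← e6]
  have e7 : (domToOrbit L ω).1 = L.1 ω.1 := rfl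
  rw [e7]
  clear h1 h2 h3 h4 h5 e1 e2 e4 hm e5 e6 e7
  generalize (fiberTransform hΓ hω₀ (fun L => shiftPart (γ L : Iso n)) f
    (domToOrbit (A⁻¹ * L) ω) : EllTwo Γ) ν = w
  ring

end CrystalShift
end

/-! ### Uniqueness of Fourier coefficients on the torus and on `ΠΩ`. -/

noncomputable section
namespace CrystalShift

/-- Trigonometric polynomials form a star subalgebra that separates points, and such an algebra
determines a finite measure. -/
theorem measure_ext_of_integral_mFourier {d : Type*} [Fintype d]
    {μ ν : Measure (UnitAddTorus d)} [IsFiniteMeasure μ] [IsFiniteMeasure ν]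
    (h : ∀ m : d → ℤ, ∫ z, UnitAddTorus.mFourier m z ∂μ = ∫ z, UnitAddTorus.mFourier m z ∂ν) :
    μ = ν := by
  let A : StarSubalgebra ℂ (BoundedContinuousFunction (UnitAddTorus d) ℂ) :=
    (UnitAddTorus.mFourierSubalgebra d).comap (BoundedContinuousFunction.toContinuousMapStarₐ ℂ)
  refine ext_of_forall_mem_subalgebra_integral_eq_of_pseudoEMetric_complete_countable
    (𝕜 := ℂ) (A := A) ?_ ?_
  · intro x y hxy
    obtain ⟨_, ⟨f, hf, rfl⟩, hne⟩ := UnitAddTorus.mFourierSubalgebra_separatesPoints hxy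
    exact ⟨_, ⟨f, ⟨BoundedContinuousFunction.mkOfCompact f, hf, rfl⟩, rfl⟩, hne⟩
  · intro g hg
    have hg' : (BoundedContinuousFunction.toContinuousMapStarₐ ℂ g : C(UnitAddTorus d, ℂ)) ∈
        Submodule.span ℂ (Set.range (UnitAddTorus.mFourier (d := d))) := by
      rw [← UnitAddTorus.mFourierSubalgebra_coe]; exact hg
    have key : ∀ f ∈ Submodule.span ℂ (Set.range (UnitAddTorus.mFourier (d := d))),
        ∫ z, f z ∂μ = ∫ z, f z ∂ν := by
      intro f hf
      have hint : ∀ (f : C(UnitAddTorus d, ℂ)) (ρ : Measure (UnitAddTorus d)) [IsFiniteMeasure ρ],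
          Integrable f ρ := fun f ρ _ =>
        (BoundedContinuousFunction.mkOfCompact f).integrable ρ
      induction hf using Submodule.span_induction with
      | mem f hf => obtain ⟨m, rfl⟩ := hf; exact h m
      | zero => simp
      | add f g _ _ hf hg =>
        simp only [ContinuousMap.add_apply]
        rw [integral_add (hint f μ) (hint g μ), integral_add (hint f ν) (hint g ν), hf, hg]
      | smul c f _ hf =>
        simp only [ContinuousMap.smul_apply]
        rw [integral_smul, integral_smul, hf]
    exact key _ hg'

/-- The positive and negative parts of `r` are densities of finite measures whose images on the
torus have equal Fourier coefficients. The images agree, and since `T` is an embedding so do the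
densities. -/
theorem ae_eq_zero_of_integral_mFourier_ofReal {d X : Type*} [Fintype d] [MeasurableSpace X]
    {μ : Measure X} {T : X → UnitAddTorus d} (hT : MeasurableEmbedding T) {r : X → ℝ}
    (hr : Integrable r μ)
    (h : ∀ m : d → ℤ, ∫ x, UnitAddTorus.mFourier m (T x) * (r x : ℂ) ∂μ = 0) : r =ᵐ[μ] 0 := by
  have hfin : ∀ {s : X → ℝ}, Integrable s μ →
      IsFiniteMeasure (μ.withDensity fun x => ENNReal.ofReal (s x)) := fun hs =>
    isFiniteMeasure_withDensity_ofReal hs.2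
  have hint : ∀ {s : X → ℝ}, Integrable s μ → ∀ m : d → ℤ,
      ∫ z, UnitAddTorus.mFourier m z ∂(μ.withDensity fun x => ENNReal.ofReal (s x)).map T =
        ∫ x, UnitAddTorus.mFourier m (T x) * ((max (s x) 0 : ℝ) : ℂ) ∂μ := by
    intro s hs m
    rw [hT.integral_map, integral_withDensity_eq_integral_toReal_smul₀
      hs.aemeasurable.ennreal_ofReal (.of_forall fun _ => ENNReal.ofReal_lt_top)]
    refine integral_congr_ae (.of_forall fun x => ?_)
    simp only [ENNReal.toReal_ofReal', Complex.real_smul]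
    ring
  have hcm : ∀ m : d → ℤ, AEStronglyMeasurable (fun x => UnitAddTorus.mFourier m (T x)) μ :=
    fun m => ((UnitAddTorus.mFourier m).continuous.measurable.comp hT.measurable).aestronglyMeasurable
  have hi : ∀ {s : X → ℝ}, Integrable s μ → ∀ m : d → ℤ,
      Integrable (fun x => UnitAddTorus.mFourier m (T x) * ((max (s x) 0 : ℝ) : ℂ)) μ := by
    intro s hs m
    refine hs.pos_part.ofReal.bdd_mul (c := 1) (hcm m) (.of_forall fun x => ?_)
    exact ((UnitAddTorus.mFourier m).norm_coe_le_norm _).trans UnitAddTorus.mFourier_norm.le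
  have h1 : (μ.withDensity fun x => ENNReal.ofReal (r x)).map T =
      (μ.withDensity fun x => ENNReal.ofReal (-r x)).map T := by
    have := hfin hr
    have := hfin hr.neg
    have : IsFiniteMeasure (μ.withDensity fun x => ENNReal.ofReal (-r x)) := this
    refine measure_ext_of_integral_mFourier fun m => ?_
    rw [hint hr, hint (s := fun x => -r x) hr.neg, ← sub_eq_zero,
      ← integral_sub (hi hr m) (hi (s := fun x => -r x) hr.neg m), ← h m]
    refine integral_congr_ae (.of_forall fun x => ?_)
    simp only
    rw [← mul_sub, ← Complex.ofReal_sub]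
    congr 2
    rcases le_total (r x) 0 with h | h
    · rw [max_eq_right h, max_eq_left (neg_nonneg.2 h)]; ring
    · rw [max_eq_left h, max_eq_right (neg_nonpos.2 h)]; ring
  have h2 : (μ.withDensity fun x => ENNReal.ofReal (r x)) =
      μ.withDensity fun x => ENNReal.ofReal (-r x) := by
    rw [← hT.comap_map (μ.withDensity fun x => ENNReal.ofReal (r x)), h1, hT.comap_map]
  have h3 := (withDensity_eq_iff hr.aemeasurable.ennreal_ofReal
    hr.neg.aemeasurable.ennreal_ofReal hr.lintegral_lt_top.ne).1 h2
  filter_upwards [h3] with x hx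
  rcases le_total (r x) 0 with h | h
  · rw [ENNReal.ofReal_of_nonpos h, eq_comm] at hx
    have := ENNReal.ofReal_eq_zero.1 hx
    simp only [Pi.neg_apply, Pi.zero_apply] at this ⊢; linarith
  · simp only [Pi.neg_apply] at hx
    rw [ENNReal.ofReal_of_nonpos (neg_nonpos.2 h)] at hx
    exact le_antisymm (ENNReal.ofReal_eq_zero.1 hx) h

theorem ae_eq_zero_of_integral_mFourier {d X : Type*} [Fintype d] [MeasurableSpace X]
    {μ : Measure X} {T : X → UnitAddTorus d} (hT : MeasurableEmbedding T) {u : X → ℂ}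
    (hu : Integrable u μ)
    (h : ∀ m : d → ℤ, ∫ x, UnitAddTorus.mFourier m (T x) * u x ∂μ = 0) : u =ᵐ[μ] 0 := by
  have hcm : ∀ m : d → ℤ, AEStronglyMeasurable (fun x => UnitAddTorus.mFourier m (T x)) μ :=
    fun m => ((UnitAddTorus.mFourier m).continuous.measurable.comp hT.measurable).aestronglyMeasurable
  have hi : ∀ {s : X → ℂ}, Integrable s μ → ∀ m : d → ℤ,
      Integrable (fun x => UnitAddTorus.mFourier m (T x) * s x) μ := by
    intro s hs m
    refine hs.bdd_mul (c := 1) (hcm m) (.of_forall fun x => ?_)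
    exact ((UnitAddTorus.mFourier m).norm_coe_le_norm _).trans UnitAddTorus.mFourier_norm.le
  have hconj : Integrable (fun x => starRingEnd ℂ (u x)) μ := by
    simpa using (Complex.conjLIE.toContinuousLinearEquiv : ℂ →L[ℝ] ℂ).integrable_comp hu
  -- Conjugating the hypothesis at `-m` gives the same vanishing for the conjugate of `u`, hence for
  -- its real and imaginary parts.
  have hc : ∀ m : d → ℤ, ∫ x, UnitAddTorus.mFourier m (T x) * starRingEnd ℂ (u x) ∂μ = 0 := by
    intro m
    have := congrArg (starRingEnd ℂ) (h (-m))
    rw [map_zero, ← integral_conj] at this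
    rw [← this]
    refine integral_congr_ae (.of_forall fun x => ?_)
    simp only [map_mul, UnitAddTorus.mFourier_neg, Complex.conj_conj]
  have hre : (fun x => (u x).re) =ᵐ[μ] 0 := by
    refine ae_eq_zero_of_integral_mFourier_ofReal hT hu.re fun m => ?_
    have : ∀ x, UnitAddTorus.mFourier m (T x) * (((u x).re : ℝ) : ℂ) = 2⁻¹ *
        (UnitAddTorus.mFourier m (T x) * u x + UnitAddTorus.mFourier m (T x) * starRingEnd ℂ (u x)) := by
      intro x; rw [Complex.re_eq_add_conj]; ring
    simp only [this]
    rw [integral_const_mul, integral_add (hi hu m) (hi hconj m), h, hc, add_zero, mul_zero]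
  have him : (fun x => (u x).im) =ᵐ[μ] 0 := by
    refine ae_eq_zero_of_integral_mFourier_ofReal hT hu.im fun m => ?_
    have : ∀ x, UnitAddTorus.mFourier m (T x) * (((u x).im : ℝ) : ℂ) = (2 * Complex.I)⁻¹ *
        (UnitAddTorus.mFourier m (T x) * u x - UnitAddTorus.mFourier m (T x) * starRingEnd ℂ (u x)) := by
      intro x; rw [Complex.im_eq_sub_conj]; ring
    simp only [this]
    rw [integral_const_mul, integral_sub (hi hu m) (hi hconj m), h, hc, sub_zero, mul_zero]
  filter_upwards [hre, him] with x h1 h2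
  exact Complex.ext h1 h2

variable {n : ℕ} {Γ : Subgroup (Iso n)} {ω₀ : Euc n}

/-- The coordinates `θ · b i` modulo `1` have the dual lattice as kernel, and by the tiling `ΠΩ`
meets each of its cosets at most once. So they embed `ΠΩ` in a torus, where the characters `e^{2πi
θ·ℓ}`, with `ℓ` an integer combination of the `b i`, become the monomials. -/
theorem ae_eq_zero_of_integral_phase (hΓ : IsCrystalGroup Γ) (hω₀ : HasTrivialStabilizer Γ ω₀)
    {u : pointOrbit Γ ω₀ → ℂ} (hu : Integrable u (restrictedVolume (pointOrbit Γ ω₀)))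
    (h : ∀ ℓ ∈ lattice Γ, ∫ θ, phase ℓ θ.1 * u θ ∂restrictedVolume (pointOrbit Γ ω₀) = 0) :
    u =ᵐ[restrictedVolume (pointOrbit Γ ω₀)] 0 := by
  obtain ⟨ι, _, b, hb, hd⟩ := exists_lattice_basis hΓ hω₀
  let T : pointOrbit Γ ω₀ → UnitAddTorus ι := fun θ i => ((⟪θ.1, b i⟫ : ℝ) : UnitAddCircle)
  have hinj : Function.Injective T := by
    intro θ θ' e
    have hν : θ.1 - θ'.1 ∈ dualLattice Γ := by
      rw [hd]
      intro i
      have h1 : ((⟪θ.1, b i⟫ : ℝ) : UnitAddCircle) = ((⟪θ'.1, b i⟫ : ℝ) : UnitAddCircle) :=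
        congrFun e i
      rw [← sub_eq_zero, ← AddCircle.coe_sub, AddCircle.coe_eq_zero_iff] at h1
      obtain ⟨k, hk⟩ := h1
      exact ⟨k, by rw [inner_sub_left, ← hk, zsmul_eq_mul, mul_one]⟩
    obtain ⟨L, ω, rfl⟩ := exists_domToOrbit_eq θ
    obtain ⟨L', ω', rfl⟩ := exists_domToOrbit_eq θ'
    have h2 : L.1 (ω.1 + (0 : dualLattice Γ).1) =
        L'.1 (ω'.1 + (⟨_, pointGroup_map_mem_dualLattice (inv_mem L'.2) hν⟩ : dualLattice Γ).1) := by
      have h3 : ∀ z, L'.1 (L'.1⁻¹ z) = z := fun z => L'.1.apply_symm_apply z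
      rw [map_add L'.1, h3]
      simp [domToOrbit]
    obtain ⟨rfl, -, e⟩ := injective_tile ω.2 ω'.2 h2
    rw [Subtype.ext e]
  have hmeas : Measurable T := by
    refine measurable_pi_lambda _ fun i => ?_
    refine (AddCircle.continuous_mk' 1).measurable.comp ?_
    exact (measurable_subtype_coe.inner_const)
  have := (measurableSet_pointOrbit hΓ hω₀).standardBorel
  refine ae_eq_zero_of_integral_mFourier (hmeas.measurableEmbedding hinj) hu fun m => ?_
  have hm : ∑ i, m i • b i ∈ lattice Γ :=
    (latticeSubmodule Γ).sum_mem fun i _ => (latticeSubmodule Γ).smul_mem _ (hb i)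
  rw [← h _ hm]
  refine integral_congr_ae (.of_forall fun θ => ?_)
  simp only
  congr 1
  simp only [UnitAddTorus.mFourier, ContinuousMap.coe_mk, T, fourier_coe_apply, phase,
    ← Complex.exp_sum, inner_sum, Complex.ofReal_sum, Finset.mul_sum]
  congr 1
  refine Finset.sum_congr rfl fun i _ => ?_
  rw [← Int.cast_smul_eq_zsmul ℝ, inner_smul_right]
  push_cast; ring

end CrystalShift
end

/-! ### Range functions generated by a sequence. -/

noncomputable section
namespace CrystalShift

variable {X H : Type*} [NormedAddCommGroup H] [InnerProductSpace ℂ H]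

/-- The range function `x ↦ closure (span {F_k(x)})` generated by a sequence of functions. -/
def spanRange (F : ℕ → X → H) (x : X) : ClosedSubmodule ℂ H :=
  (Submodule.span ℂ (Set.range fun k => F k x)).closure

theorem mem_spanRange (F : ℕ → X → H) (x : X) (k : ℕ) : F k x ∈ spanRange F x :=
  subset_closure (Submodule.subset_span ⟨k, rfl⟩)

theorem spanRange_le {F : ℕ → X → H} {x : X} {K : ClosedSubmodule ℂ H} (h : ∀ k, F k x ∈ K) :
    spanRange F x ≤ K := by
  rw [spanRange, Submodule.closure_le, Submodule.span_le]
  rintro _ ⟨k, rfl⟩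
  exact h k

theorem eq_zero_of_mem_spanRange {F : ℕ → X → H} {x : X} {ξ : H} (hξ : ξ ∈ spanRange F x)
    (h : ∀ k, inner ℂ (F k x) ξ = 0) : ξ = 0 := by
  have hle : spanRange F x ≤ ⟨(ℂ ∙ ξ)ᗮ, Submodule.isClosed_orthogonal _⟩ := spanRange_le fun k =>
    Submodule.mem_orthogonal_singleton_iff_inner_left.2 (h k)
  exact inner_self_eq_zero.1 (Submodule.mem_orthogonal_singleton_iff_inner_left.1 (hle hξ))

/-- The combinations of the vectors `F_k(x)` with coefficients in a fixed countable dense set. -/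
def countableComb (F : ℕ → X → H) (l : List (ℕ × ℕ)) (x : X) : H :=
  (l.map fun p => TopologicalSpace.denseSeq ℂ p.1 • F p.2 x).sum

theorem countableComb_mem (F : ℕ → X → H) (l : List (ℕ × ℕ)) (x : X) :
    countableComb F l x ∈ spanRange F x := by
  induction l with
  | nil => simp [countableComb]
  | cons p l ih =>
    have : countableComb F (p :: l) x
        = TopologicalSpace.denseSeq ℂ p.1 • F p.2 x + countableComb F l x := by
      simp [countableComb]
    rw [this]
    exact add_mem (SMulMemClass.smul_mem _ (mem_spanRange F x _)) ih

theorem mem_closure_range_countableComb {F : ℕ → X → H} {x : X} {ξ : H}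
    (hξ : ξ ∈ spanRange F x) : ξ ∈ closure (Set.range fun l => countableComb F l x) := by
  let S : AddSubmonoid H :=
    { carrier := Set.range fun l => countableComb F l x
      zero_mem' := ⟨[], rfl⟩
      add_mem' := by
        rintro _ _ ⟨l, rfl⟩ ⟨m, rfl⟩
        exact ⟨l ++ m, by simp [countableComb]⟩ }
  -- The coefficients in `S` only run through a dense sequence; continuity in the scalar recovers
  -- all of `ℂ` in the closure.
  have hsmul : ∀ (c : ℂ) (k : ℕ), c • F k x ∈ S.topologicalClosure := by
    intro c k
    refine (map_mem_closure (f := fun c : ℂ => c • F k x) (by fun_prop)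
      (TopologicalSpace.denseRange_denseSeq ℂ c) ?_ :
      _ ∈ closure (S : Set H))
    rintro _ ⟨j, rfl⟩
    exact ⟨[(j, k)], by simp [countableComb]⟩
  have hspan : (Submodule.span ℂ (Set.range fun k => F k x) : Set H) ⊆ S.topologicalClosure := by
    intro y hy
    obtain ⟨c, rfl⟩ := (Finsupp.mem_span_range_iff_exists_finsupp).1 hy
    exact sum_mem fun k _ => hsmul _ _
  exact closure_minimal hspan S.isClosed_topologicalClosure hξ

variable [MeasurableSpace X] [CompleteSpace H]

/-- This norm is the distance from `ξ` to the span, an infimum over countably many measurable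
combinations. -/
theorem measurable_norm_sub_starProjection_spanRange {F : ℕ → X → H}
    (hF : ∀ k, StronglyMeasurable (F k)) (ξ : H) :
    Measurable fun x => ‖ξ - (spanRange F x).toSubmodule.starProjection ξ‖ := by
  have hmeas : ∀ l, StronglyMeasurable (countableComb F l) := by
    intro l
    induction l with
    | nil => exact stronglyMeasurable_const
    | cons p l ih =>
      have : countableComb F (p :: l)
          = fun x => TopologicalSpace.denseSeq ℂ p.1 • F p.2 x + countableComb F l x := by
        funext x; simp [countableComb]
      rw [this]
      exact ((hF _).const_smul _).add ih
  refine measurable_of_Iio fun c => ?_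
  have : (fun x => ‖ξ - (spanRange F x).toSubmodule.starProjection ξ‖) ⁻¹' Set.Iio c
      = ⋃ l, {x | ‖ξ - countableComb F l x‖ < c} := by
    ext x
    simp only [Set.mem_preimage, Set.mem_Iio, Set.mem_iUnion, Set.mem_ofPred_eq]
    constructor
    · intro h
      have h1 := mem_closure_range_countableComb (F := F) (x := x)
        (ξ := (spanRange F x).toSubmodule.starProjection ξ)
        (Submodule.starProjection_apply_mem _ ξ)
      obtain ⟨_, hy, ⟨l, rfl⟩⟩ := mem_closure_iff.1 h1 {y | ‖ξ - y‖ < c}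
        (isOpen_lt (by fun_prop) continuous_const) h
      exact ⟨l, hy⟩
    · rintro ⟨l, hl⟩
      refine lt_of_le_of_lt ?_ hl
      rw [Submodule.starProjection_minimal]
      exact ciInf_le ⟨0, Set.forall_mem_range.mpr fun _ => norm_nonneg _⟩
        (⟨countableComb F l x, countableComb_mem F l x⟩ : (spanRange F x).toSubmodule)
  rw [this]
  exact MeasurableSet.iUnion fun l => measurableSet_lt
    (stronglyMeasurable_const.sub (hmeas l)).norm.measurable measurable_const

/-- Pythagoras gives `⟨Pξ, ξ⟩ = ‖ξ‖² - ‖ξ - Pξ‖²`, which is measurable; polarization gives the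
off-diagonal entries. -/
theorem isMeasurableRangeFunction_spanRange {F : ℕ → X → H}
    (hF : ∀ k, StronglyMeasurable (F k)) : IsMeasurableRangeFunction (spanRange F) := by
  have hdiag : ∀ ξ : H, Measurable fun x =>
      inner ℂ ((spanRange F x).toSubmodule.starProjection ξ) ξ := by
    intro ξ
    have : ∀ x, inner ℂ ((spanRange F x).toSubmodule.starProjection ξ) ξ =
        ((‖ξ‖ ^ 2 - ‖ξ - (spanRange F x).toSubmodule.starProjection ξ‖ ^ 2 : ℝ) : ℂ) := by
      intro x
      set P := (spanRange F x).toSubmodule.starProjection ξ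
      have h0 : inner ℂ P (ξ - P) = 0 :=
        Submodule.inner_right_of_mem_orthogonal (Submodule.starProjection_apply_mem _ ξ)
          (Submodule.sub_starProjection_mem_orthogonal ξ)
      have h1 : inner ℂ P ξ = inner ℂ P P := by
        rw [inner_sub_right, sub_eq_zero] at h0; exact h0
      have h2 := norm_add_sq_eq_norm_sq_add_norm_sq_of_inner_eq_zero P (ξ - P) h0
      rw [add_sub_cancel] at h2
      have h3 : ‖ξ‖ ^ 2 - ‖ξ - P‖ ^ 2 = ‖P‖ ^ 2 := by simp only [sq]; linarith
      rw [h1, inner_self_eq_norm_sq_to_K, h3]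
      simp
    simp only [this]
    exact Complex.measurable_ofReal.comp (measurable_const.sub
      ((measurable_norm_sub_starProjection_spanRange hF ξ).pow_const 2))
  intro ξ η
  have hpol : ∀ x, inner ℂ ((spanRange F x).toSubmodule.starProjection ξ) η = _ := fun x =>
    inner_map_polarization' ((spanRange F x).toSubmodule.starProjection : H →ₗ[ℂ] H) ξ η
  simp only [ContinuousLinearMap.coe_coe] at hpol
  simp only [hpol]
  exact ((((hdiag _).sub (hdiag _)).sub ((hdiag _).const_mul _)).add
    ((hdiag _).const_mul _)).div_const _

end CrystalShift
end

/-! ### Invariant subspaces and range functions. -/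

noncomputable section
namespace CrystalShift

variable {n : ℕ} {Γ : Subgroup (Iso n)} {ω₀ : Euc n}

/-- A sequence converging in `L²` has a subsequence converging almost everywhere, and each `J x` is
closed. -/
theorem isClosed_rangeSpace {X H : Type*} [MeasurableSpace X] (μ : Measure X)
    [NormedAddCommGroup H] [InnerProductSpace ℂ H] (J : X → ClosedSubmodule ℂ H) :
    IsClosed (rangeSpace μ J) := by
  refine IsSeqClosed.isClosed fun F G hF hFG => ?_
  obtain ⟨φ, -, hφ⟩ := (tendstoInMeasure_of_tendsto_Lp hFG).exists_seq_tendsto_ae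
  have hall : ∀ᵐ x ∂μ, ∀ k, F k x ∈ J x := ae_all_iff.2 hF
  change ∀ᵐ x ∂μ, G x ∈ J x
  filter_upwards [hall, hφ] with x h1 h2
  exact (J x).isClosed.mem_of_tendsto h2 (.of_forall fun k => h1 _)

theorem inner_fiberTransform_eq_zero (hΓ : IsCrystalGroup Γ) (hω₀ : HasTrivialStabilizer Γ ω₀)
    (γ : pointGroup Γ → Γ) (hγ : ∀ M : pointGroup Γ, linPart (γ M : Iso n) = M) {f q : LTwo n}
    (h : ∀ ℓ ∈ lattice Γ, inner ℂ (shift (AffineIsometryEquiv.constVAdd ℝ (Euc n) ℓ) f) q = 0) :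
    ∀ᵐ θ ∂restrictedVolume (pointOrbit Γ ω₀),
      inner ℂ (fiberTransform hΓ hω₀ (fun L => shiftPart (γ L : Iso n)) f θ)
        (fiberTransform hΓ hω₀ (fun L => shiftPart (γ L : Iso n)) q θ) = 0 := by
  set T := fiberTransform hΓ hω₀ (fun L => shiftPart (γ L : Iso n)) with hT
  refine ae_eq_zero_of_integral_phase hΓ hω₀ (L2.integrable_inner (T f) (T q)) fun ℓ hℓ => ?_
  -- The shift stands in the conjugate-linear slot, so the coefficient at `ℓ` comes from the
  -- translation by `-ℓ`.
  have hℓ' : -ℓ ∈ lattice Γ := mem_latticeSubmodule.1 (neg_mem (mem_latticeSubmodule.2 hℓ))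
  rw [← h _ hℓ', ← T.inner_map_map, L2.inner_def]
  refine integral_congr_ae ?_
  filter_upwards [fiberTransform_shift hΓ hω₀ γ hγ f hℓ' 1 (linPart_constVAdd _).symm] with θ hθ
  have h1 : orbitAct (1⁻¹ : pointGroup Γ) θ = θ := by
    apply Subtype.ext; simp [orbitAct]
  have h2 : (AffineIsometryEquiv.constVAdd ℝ (Euc n) (-ℓ)) 0 = -ℓ := by simp
  have h3 : starRingEnd ℂ (phase (-ℓ) θ.1) = phase ℓ θ.1 := by
    simp only [phase, inner_neg_right, ← Complex.exp_conj, map_mul, Complex.conj_ofReal,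
      Complex.conj_I, Complex.ofReal_neg, map_neg, map_ofNat]
    congr 1; ring
  rw [hθ, h1, h2, inner_smul_left, h3]

theorem isShiftInvariant_of_rangeFunction (hΓ : IsCrystalGroup Γ)
    (hω₀ : HasTrivialStabilizer Γ ω₀) (γ : pointGroup Γ → Γ)
    (hγ : ∀ M : pointGroup Γ, linPart (γ M : Iso n) = M) {V : ClosedSubmodule ℂ (LTwo n)}
    {J : pointOrbit Γ ω₀ → ClosedSubmodule ℂ (EllTwo Γ)} (hJ : IsPointInvariant J)
    (hV : ∀ f, f ∈ V ↔ fiberTransform hΓ hω₀ (fun L => shiftPart (γ L : Iso n)) f ∈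
      rangeSpace (restrictedVolume (pointOrbit Γ ω₀)) J) : IsShiftInvariant Γ V := by
  intro g hg f hf
  rw [hV] at hf ⊢
  let A : pointGroup Γ := ⟨linPart g, g, hg, rfl⟩
  change ∀ᵐ θ ∂_, _
  filter_upwards [fiberTransform_shift hΓ hω₀ γ hγ f hg A rfl, hJ A⁻¹,
    ae_orbitAct hΓ hω₀ hf A⁻¹] with θ h1 h2 h3
  rw [h1, ← h2]
  exact SMulMemClass.smul_mem _ h3

theorem exists_rangeFunction_of_isShiftInvariant (hΓ : IsCrystalGroup Γ)
    (hω₀ : HasTrivialStabilizer Γ ω₀) (γ : pointGroup Γ → Γ)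
    (hγ : ∀ M : pointGroup Γ, linPart (γ M : Iso n) = M) {V : ClosedSubmodule ℂ (LTwo n)}
    (hV : IsShiftInvariant Γ V) :
    ∃ J : pointOrbit Γ ω₀ → ClosedSubmodule ℂ (EllTwo Γ),
      IsMeasurableRangeFunction J ∧ IsPointInvariant J ∧
        ∀ f, f ∈ V ↔ fiberTransform hΓ hω₀ (fun L => shiftPart (γ L : Iso n)) f ∈
          rangeSpace (restrictedVolume (pointOrbit Γ ω₀)) J := by
  set T := fiberTransform hΓ hω₀ (fun L => shiftPart (γ L : Iso n)) with hT
  have : Fact ((2 : ℝ≥0∞) ≠ ∞) := ⟨ENNReal.ofNat_ne_top⟩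
  have : SecondCountableTopology (LTwo n) := inferInstance
  have : TopologicalSpace.SeparableSpace V :=
    inferInstanceAs (TopologicalSpace.SeparableSpace (V : Set (LTwo n)))
  have hne : Nonempty V := ⟨⟨0, zero_mem V⟩⟩
  let f : ℕ → LTwo n := fun k => (TopologicalSpace.denseSeq V k : V)
  have hfV : ∀ k, f k ∈ V := fun k => (TopologicalSpace.denseSeq V k).2
  let F : ℕ → pointOrbit Γ ω₀ → EllTwo Γ := fun k => T (f k)
  have hsub : ∀ p ∈ V, T p ∈ rangeSpace (restrictedVolume (pointOrbit Γ ω₀)) (spanRange F) := by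
    intro p hp
    refine (TopologicalSpace.denseRange_denseSeq V).induction_on
      (p := fun v : V => T v.1 ∈ rangeSpace (restrictedVolume (pointOrbit Γ ω₀)) (spanRange F))
      ⟨p, hp⟩ ((isClosed_rangeSpace _ _).preimage (T.continuous.comp continuous_subtype_val)) ?_
    exact fun k => (.of_forall fun θ => mem_spanRange F θ k :
      ∀ᵐ θ ∂restrictedVolume (pointOrbit Γ ω₀), F k θ ∈ spanRange F θ)
  have hle : ∀ L : pointGroup Γ, ∀ᵐ θ ∂restrictedVolume (pointOrbit Γ ω₀),
      spanRange F (orbitAct L θ) ≤ spanRange F θ := by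
    intro L
    -- Up to a nonzero scalar, the generator `T (f k)` at `Lθ` is the value at `θ` of the transform
    -- of a shift of `f k`, which is again in `V`.
    have h1 : ∀ᵐ θ ∂restrictedVolume (pointOrbit Γ ω₀), ∀ k,
        T (shift (γ L⁻¹ : Iso n) (f k)) θ ∈ spanRange F θ :=
      ae_all_iff.2 fun k => hsub _ (hV _ (γ L⁻¹).2 _ (hfV k))
    have h2 : ∀ᵐ θ ∂restrictedVolume (pointOrbit Γ ω₀), ∀ k, _ :=
      ae_all_iff.2 fun k => fiberTransform_shift hΓ hω₀ γ hγ (f k) (γ L⁻¹).2 L⁻¹ (hγ _).symm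
    filter_upwards [h1, h2] with θ h1 h2
    refine spanRange_le fun k => ?_
    have h3 := h1 k
    rw [hT, h2 k, inv_inv] at h3
    have h4 := SMulMemClass.smul_mem (phase ((γ L⁻¹ : Iso n) 0) θ.1)⁻¹ h3
    rwa [inv_smul_smul₀ (phase_ne_zero _ _)] at h4
  refine ⟨spanRange F, isMeasurableRangeFunction_spanRange fun k => Lp.stronglyMeasurable _, ?_,
    fun p => ⟨hsub p, fun hp => ?_⟩⟩
  · intro L
    -- The reverse inclusion is the one for `L⁻¹`, read at the point `Lθ`.
    filter_upwards [hle L, ae_orbitAct hΓ hω₀ (hle L⁻¹) L] with θ h1 h2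
    have h3 : orbitAct L⁻¹ (orbitAct L θ) = θ := Subtype.ext (L.1.symm_apply_apply θ.1)
    rw [h3] at h2
    exact le_antisymm h1 h2
  · set r := V.toSubmodule.starProjection p
    have hr : r ∈ V := Submodule.starProjection_apply_mem _ p
    have hq : p - r ∈ V.toSubmoduleᗮ := Submodule.sub_starProjection_mem_orthogonal p
    have hzero : ∀ᵐ θ ∂restrictedVolume (pointOrbit Γ ω₀), ∀ k,
        inner ℂ (T (f k) θ) (T (p - r) θ) = 0 := ae_all_iff.2 fun k =>
      inner_fiberTransform_eq_zero hΓ hω₀ γ hγ fun ℓ hℓ =>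
        Submodule.inner_right_of_mem_orthogonal (hV _ hℓ _ (hfV k)) hq
    have h0 : T (p - r) = 0 := by
      rw [Lp.eq_zero_iff_ae_eq_zero]
      have hp' : ∀ᵐ θ ∂restrictedVolume (pointOrbit Γ ω₀), T p θ ∈ spanRange F θ := hp
      have hr' : ∀ᵐ θ ∂restrictedVolume (pointOrbit Γ ω₀), T r θ ∈ spanRange F θ := hsub r hr
      filter_upwards [hzero, hp', hr', Lp.coeFn_sub (T p) (T r)] with θ h1 h2 h3 h4
      refine eq_zero_of_mem_spanRange (F := F) (x := θ) ?_ h1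
      rw [map_sub, h4]
      exact (spanRange F θ).toSubmodule.sub_mem h2 h3
    have h5 : p = r := sub_eq_zero.1 (T.injective (h0.trans T.map_zero.symm))
    rw [h5]; exact hr

end CrystalShift
end

open CrystalShift
theorem theorem6p3 {n : ℕ} (hn : 0 < n) (Γ : Subgroup (Iso n)) (hΓ : IsCrystalGroup Γ)
    (γ : pointGroup Γ → Γ) (hγ : ∀ M : pointGroup Γ, linPart (γ M : Iso n) = M)
    (ω₀ : Euc n) (hω₀ : HasTrivialStabilizer Γ ω₀)
    (V : ClosedSubmodule ℂ (LTwo n)) :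
    IsShiftInvariant Γ V ↔
      ∃ J : pointOrbit Γ ω₀ → ClosedSubmodule ℂ (EllTwo Γ),
        IsMeasurableRangeFunction J ∧ IsPointInvariant J ∧
          ∀ f : LTwo n, f ∈ V ↔
            ∃ F ∈ rangeSpace (restrictedVolume (pointOrbit Γ ω₀)) J,
              IsFiberTransform (fun L => shiftPart (γ L : Iso n)) f F := by
  simp only [isFiberTransform_iff_eq hΓ hω₀, exists_eq_right]
  exact ⟨exists_rangeFunction_of_isShiftInvariant hΓ hω₀ γ hγ, fun ⟨_, _, hJ, h⟩ =>
    isShiftInvariant_of_rangeFunction hΓ hω₀ γ hγ hJ h⟩
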